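/- Let $M$ be a smooth connected affine algebraic variety over $\mathbf C$ and let $\nabla$ be a linear connection on its tangent bundle $TM$, rational or regular (a regular connection being a rational one without poles). Its reciprocal connection is $$\nabla^{\rm rec}_X Y=\nabla_Y X+[X,Y],$$ and its torsion is $\operatorname{Tor}_\nabla(X,Y)=\nabla_XY-\nabla_YX-[X,Y]$. A connection is flat if its curvature $\nabla_X\nabla_Y-\nabla_Y\nabla_X-\nabla_{[X,Y]}$ vanishes. A vector field $Y$ is $\nabla$-horizontal if $\nabla_XY=0$ for every $X$. The connection $\nabla$ is called a Lie connection if it is flat and, near every complex point of $M$ at which $\nabla$ is regular, the Lie bracket of any two local complex analytic $\nabla$-horizontal vector fields is again $\nabla$-horizontal. Then the following statements are equivalent: 1. $\nabla$ is a Lie connection; 2. $\nabla^{\rm rec}$ is a Lie connection; 3. $\nabla$ is flat and its torsion is parallel, $\nabla\operatorname{Tor}_\nabla=0$, that is, $\nabla_X(\operatorname{Tor}_\nabla(Y,Z))-\operatorname{Tor}_\nabla(\nabla_XY,Z)-\operatorname{Tor}_\nabla(Y,\nabla_XZ)=0$ for all rational vector fields $X,Y,Z$ on $M$; 4. $\nabla$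 and $\nabla^{\rm rec}$ are both flat. -/

import Mathlib

open Filter Topology

noncomputable section

namespace LieConn

section Connections

/-- A linear connection on the module of vector fields `Der_k(R)`, given by its covariant
derivative `cov X Y = ∇_X Y`: it is `R`-linear in `X`, `k`-linear in `Y` and satisfies the Leibniz
rule in `Y`. For `R` the field of rational functions of a variety `M` this is a rational linear
connection on `TM`; for `R` the ring of germs of analytic functions at a point it is a germ of
analytic connection on `TM`. -/
structure Connection (k R : Type*) [CommRing k] [CommRing R] [Algebra k R] where
  cov : Derivation k R R →ₗ[R] Derivation k R R →ₗ[k] Derivation k R R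
  leibniz : ∀ (X Y : Derivation k R R) (f : R), cov X (f • Y) = X f • Y + f • cov X Y

variable {k R : Type*} [CommRing k] [CommRing R] [Algebra k R]

theorem smul_lie_der (X Y : Derivation k R R) (f : R) :
    ⁅f • X, Y⁆ = f • ⁅X, Y⁆ - Y f • X := by
  ext a
  simp only [Derivation.commutator_apply, Derivation.smul_apply, Derivation.sub_apply,
    smul_eq_mul, Derivation.leibniz]
  ring

theorem lie_smul_der (X Y : Derivation k R R) (f : R) :
    ⁅X, f • Y⁆ = f • ⁅X, Y⁆ + X f • Y := by
  ext a
  simp only [Derivation.commutator_apply, Derivation.smul_apply, Derivation.add_apply,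
    smul_eq_mul, Derivation.leibniz]
  ring

namespace Connection

/-- The reciprocal connection `∇^rec_X Y = ∇_Y X + [X, Y]`. -/
def reciprocal (D : Connection k R) : Connection k R where
  cov :=
    { toFun := fun X =>
        { toFun := fun Y => D.cov Y X + ⁅X, Y⁆
          map_add' := fun Y Z => by
            simp only [map_add, LinearMap.add_apply, lie_add]; abel
          map_smul' := fun c Y => by
            have h : D.cov (c • Y) X = c • D.cov Y X := by
              rw [← algebraMap_smul R c Y, map_smul, LinearMap.smul_apply, algebraMap_smul]
            simp only [h, lie_smul, smul_add, RingHom.id_apply] }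
      map_add' := fun X Y => by
        ext1 Z
        simp only [LinearMap.coe_mk, AddHom.coe_mk, LinearMap.add_apply, map_add, add_lie]; abel
      map_smul' := fun f X => by
        ext1 Y
        simp only [LinearMap.coe_mk, AddHom.coe_mk, LinearMap.smul_apply, RingHom.id_apply,
          D.leibniz, smul_lie_der, smul_add]
        abel }
  leibniz := fun X Y f => by
    simp only [LinearMap.coe_mk, AddHom.coe_mk, map_smul, LinearMap.smul_apply, lie_smul_der,
      smul_add]
    abel

/-- The curvature `R(X, Y) Z = ∇_X ∇_Y Z - ∇_Y ∇_X Z - ∇_[X,Y] Z`. -/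
def curvature (D : Connection k R) (X Y Z : Derivation k R R) : Derivation k R R :=
  D.cov X (D.cov Y Z) - D.cov Y (D.cov X Z) - D.cov ⁅X, Y⁆ Z

def IsFlat (D : Connection k R) : Prop :=
  ∀ X Y Z, D.curvature X Y Z = 0

/-- The torsion `Tor(X, Y) = ∇_X Y - ∇_Y X - [X, Y]`. -/
def torsion (D : Connection k R) (X Y : Derivation k R R) : Derivation k R R :=
  D.cov X Y - D.cov Y X - ⁅X, Y⁆

/-- The covariant derivative of the torsion tensor,
`(∇_X Tor)(Y, Z) = ∇_X (Tor(Y, Z)) - Tor(∇_X Y, Z) - Tor(Y, ∇_X Z)`. -/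
def covTorsion (D : Connection k R) (X Y Z : Derivation k R R) : Derivation k R R :=
  D.cov X (D.torsion Y Z) - D.torsion (D.cov X Y) Z - D.torsion Y (D.cov X Z)

/-- `∇ Tor = 0`. -/
def HasParallelTorsion (D : Connection k R) : Prop :=
  ∀ X Y Z, D.covTorsion X Y Z = 0

/-- `Y` is horizontal: `∇_X Y = 0` for all `X`. -/
def IsHorizontal (D : Connection k R) (Y : Derivation k R R) : Prop :=
  ∀ X, D.cov X Y = 0

end Connection

end Connections

section Analytic

variable (A : Type*) [CommRing A] [Algebra ℂ A]

/-- The complex points of the affine variety with coordinate ring `A`. -/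
structure Point where
  eval : A →ₐ[ℂ] ℂ

/-- The classical (Euclidean) topology: the coarsest one for which all regular functions are
continuous. -/
instance : TopologicalSpace (Point A) :=
  TopologicalSpace.induced (fun (x : Point A) (a : A) => x.eval a) inferInstance

variable {A}

/-- Germs of complex-valued functions form a complex algebra, with Mathlib's pointwise operations. -/
instance germAlgebra {P : Type*} (l : Filter P) : Algebra ℂ (Germ l ℂ) :=
  Algebra.ofModule
    (fun c f g => by
      induction f using Germ.inductionOn
      induction g using Germ.inductionOn
      exact congrArg Germ.ofFun (smul_mul_assoc c _ _))
    (fun c f g => by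
      induction f using Germ.inductionOn
      induction g using Germ.inductionOn
      exact congrArg Germ.ofFun (mul_smul_comm c _ _))

/-- The ring of germs at `x` of analytic functions on the variety: the germs of the
functions `y ↦ F (a₁(y), …, aₙ(y))` with `a₁, …, aₙ` regular functions and `F` a function on `ℂⁿ`
that is analytic at `(a₁(x), …, aₙ(x))`. -/
def AnalyticGerm (x : Point A) : Subalgebra ℂ (Germ (𝓝 x) ℂ) where
  carrier := {g | ∃ (n : ℕ) (a : Fin n → A) (F : (Fin n → ℂ) → ℂ),
    AnalyticAt ℂ F (fun i => x.eval (a i)) ∧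
      g = ((fun y : Point A => F (fun i => y.eval (a i)) : Point A → ℂ) : Germ (𝓝 x) ℂ)}
  add_mem' := by
    rintro _ _ ⟨m, a, F, hF, rfl⟩ ⟨n, b, G, hG, rfl⟩
    refine ⟨m + n, Fin.append a b,
      fun z => F (fun i => z (Fin.castAdd n i)) + G (fun i => z (Fin.natAdd m i)), ?_, ?_⟩
    · refine AnalyticAt.add ?_ ?_
      · refine AnalyticAt.fun_comp (g := F) (f := fun (z : Fin (m + n) → ℂ) i => z (Fin.castAdd n i))
          (by simpa using hF) ?_
        exact AnalyticAt.pi fun i =>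
          (ContinuousLinearMap.proj (R := ℂ) (φ := fun _ : Fin (m + n) => ℂ)
            (Fin.castAdd n i)).analyticAt _
      · refine AnalyticAt.fun_comp (g := G) (f := fun (z : Fin (m + n) → ℂ) i => z (Fin.natAdd m i))
          (by simpa using hG) ?_
        exact AnalyticAt.pi fun i =>
          (ContinuousLinearMap.proj (R := ℂ) (φ := fun _ : Fin (m + n) => ℂ)
            (Fin.natAdd m i)).analyticAt _
    · simp only [Fin.append_left, Fin.append_right]
      rfl
  mul_mem' := by
    rintro _ _ ⟨m, a, F, hF, rfl⟩ ⟨n, b, G, hG, rfl⟩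
    refine ⟨m + n, Fin.append a b,
      fun z => F (fun i => z (Fin.castAdd n i)) * G (fun i => z (Fin.natAdd m i)), ?_, ?_⟩
    · refine AnalyticAt.mul ?_ ?_
      · refine AnalyticAt.fun_comp (g := F) (f := fun (z : Fin (m + n) → ℂ) i => z (Fin.castAdd n i))
          (by simpa using hF) ?_
        exact AnalyticAt.pi fun i =>
          (ContinuousLinearMap.proj (R := ℂ) (φ := fun _ : Fin (m + n) => ℂ)
            (Fin.castAdd n i)).analyticAt _
      · refine AnalyticAt.fun_comp (g := G) (f := fun (z : Fin (m + n) → ℂ) i => z (Fin.natAdd m i))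
          (by simpa using hG) ?_
        exact AnalyticAt.pi fun i =>
          (ContinuousLinearMap.proj (R := ℂ) (φ := fun _ : Fin (m + n) => ℂ)
            (Fin.natAdd m i)).analyticAt _
    · simp only [Fin.append_left, Fin.append_right]
      rfl
  algebraMap_mem' := fun c => ⟨0, Fin.elim0, fun _ => c, analyticAt_const, by
    rw [Algebra.algebraMap_eq_smul_one]
    exact congrArg Germ.ofFun (funext fun _ => mul_one c)⟩

/-- The analytic germ at `x` of a regular function. -/
def regularGerm (x : Point A) (a : A) : AnalyticGerm x :=
  ⟨((fun y : Point A => y.eval a : Point A → ℂ) : Germ (𝓝 x) ℂ),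
    1, fun _ => a, fun z => z 0,
    (ContinuousLinearMap.proj (R := ℂ) (φ := fun _ : Fin 1 => ℂ) 0).analyticAt _, rfl⟩

variable {K : Type*} [Field K] [Algebra A K] [Algebra ℂ K]

/-- `g` is the analytic germ at `x` of the rational function `f`: for some regular functions `b` and
`c ≠ 0`, `f = b / c` as rational functions and `g c = b` as germs at `x`. -/
def IsFunctionGerm (x : Point A) (f : K) (g : AnalyticGerm x) : Prop :=
  ∃ b c : A, algebraMap A K c ≠ 0 ∧ f * algebraMap A K c = algebraMap A K b ∧
    g * regularGerm x c = regularGerm x b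

/-- `V` is the analytic germ at `x` of the rational vector field `X`
(in particular `X` is regular at `x`). -/
def IsFieldGerm (x : Point A) (X : Derivation ℂ K K)
    (V : Derivation ℂ (AnalyticGerm x) (AnalyticGerm x)) : Prop :=
  ∀ a : A, IsFunctionGerm x (X (algebraMap A K a)) (V (regularGerm x a))

/-- `E` is the analytic germ at `x` of the rational connection `D`: a germ of analytic connection
on the tangent bundle that agrees with `D` on the rational vector fields regular at `x`.
On a smooth variety it exists exactly when `D` is regular at `x`, and then it is unique, since
the vector fields regular at `x` span those with analytic coefficients. -/
def IsConnectionGerm (x : Point A) (D : Connection ℂ K) (E : Connection ℂ (AnalyticGerm x)) : Prop :=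
  ∀ (X Y : Derivation ℂ K K) (V W : Derivation ℂ (AnalyticGerm x) (AnalyticGerm x)),
    IsFieldGerm x X V → IsFieldGerm x Y W → IsFieldGerm x (D.cov X Y) (E.cov V W)

variable (A) in
/-- A rational connection `D` on the tangent bundle of the affine variety with coordinate ring
`A` and function field `K` is a Lie connection if it is flat and, around every point where `D` is
regular, the Lie bracket of two local analytic horizontal vector fields is horizontal.
A regular connection is the particular case where all points are regular for `D`. -/
def IsLieConnection (D : Connection ℂ K) : Prop :=
  D.IsFlat ∧ ∀ (x : Point A) (E : Connection ℂ (AnalyticGerm x)), IsConnectionGerm x D E →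
    ∀ Y Z : Derivation ℂ (AnalyticGerm x) (AnalyticGerm x),
      E.IsHorizontal Y → E.IsHorizontal Z → E.IsHorizontal ⁅Y, Z⁆

end Analytic

end LieConn

end

noncomputable section

namespace LieConn

/-!
The algebraic core is the identity `Rʳᵉᶜ(X, Y) Z = (∇_Z Tor)(X, Y) - R(Y, Z) X + R(X, Z) Y` between
the curvatures of `∇` and `∇ʳᵉᶜ`: for flat `∇` it makes flatness of `∇ʳᵉᶜ` equivalent to parallel
torsion, and `∇ ↦ ∇ʳᵉᶜ` is an involution.

Horizontal fields satisfy `Tor(Y, Z) = -[Y, Z]`, hence `(∇_X Tor)(Y, Z) = -∇_X [Y, Z]`. So parallel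
torsion makes brackets of horizontal fields horizontal, and the converse holds wherever the
horizontal fields span. To pass from rational fields to analytic germs, standard smooth coordinates
and the implicit function theorem identify the germs at a point with the germs at the origin of a
`ℂ^κ`. There a flat connection has a horizontal frame: integrate along rays, where the solution of
the linear equation is a Neumann series of Volterra operators and depends analytically on the
endpoint. Finally a rational function whose germ vanishes is zero, because étale coordinates are
algebraically independent and a polynomial is determined by its germ, so `∇ Tor = 0` may be tested
on germs at a single point.
-/

section Algebra

variable {k R : Type*} [CommRing k] [CommRing R] [Algebra k R]

namespace Connection

theorem reciprocal_cov (D : Connection k R) (X Y : Derivation k R R) :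
    D.reciprocal.cov X Y = D.cov Y X + ⁅X, Y⁆ := rfl

theorem cov_ext {D E : Connection k R} (h : ∀ X Y, D.cov X Y = E.cov X Y) : D = E := by
  cases D
  cases E
  congr 1
  ext1 X
  ext1 Y
  exact h X Y

theorem reciprocal_reciprocal (D : Connection k R) : D.reciprocal.reciprocal = D := by
  refine cov_ext fun X Y => ?_
  rw [reciprocal_cov, reciprocal_cov, ← lie_skew X Y]
  abel

theorem reciprocal_curvature (D : Connection k R) (X Y Z : Derivation k R R) :
    D.reciprocal.curvature X Y Z =
      D.covTorsion Z X Y - D.curvature Y Z X + D.curvature X Z Y := by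
  have hJ : ⁅X, ⁅Y, Z⁆⁆ = ⁅⁅X, Y⁆, Z⁆ + ⁅Y, ⁅X, Z⁆⁆ := leibniz_lie X Y Z
  have hs : ⁅D.cov Z X, Y⁆ = -⁅Y, D.cov Z X⁆ := (lie_skew _ _).symm
  simp only [curvature, covTorsion, torsion, reciprocal_cov, map_add, map_sub, hJ, hs]
  abel

theorem IsFlat.hasParallelTorsion_iff {D : Connection k R} (hD : D.IsFlat) :
    D.HasParallelTorsion ↔ D.reciprocal.IsFlat := by
  constructor
  · intro h X Y Z
    rw [reciprocal_curvature, h, hD, hD]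
    simp
  · intro h X Y Z
    have := reciprocal_curvature D Y Z X
    rw [h, hD, hD] at this
    simpa using this.symm

theorem torsion_add_left (D : Connection k R) (X X' Y : Derivation k R R) :
    D.torsion (X + X') Y = D.torsion X Y + D.torsion X' Y := by
  simp only [torsion, map_add, LinearMap.add_apply, add_lie]
  abel

theorem torsion_add_right (D : Connection k R) (X Y Y' : Derivation k R R) :
    D.torsion X (Y + Y') = D.torsion X Y + D.torsion X Y' := by
  simp only [torsion, map_add, LinearMap.add_apply, lie_add]
  abel

theorem torsion_smul_left (D : Connection k R) (f : R) (X Y : Derivation k R R) :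
    D.torsion (f • X) Y = f • D.torsion X Y := by
  simp only [torsion, map_smul, LinearMap.smul_apply, D.leibniz, smul_lie_der, smul_sub]
  abel

theorem torsion_smul_right (D : Connection k R) (f : R) (X Y : Derivation k R R) :
    D.torsion X (f • Y) = f • D.torsion X Y := by
  simp only [torsion, map_smul, LinearMap.smul_apply, D.leibniz, lie_smul_der, smul_sub]
  abel

/-- The covariant derivative of the torsion as a tensor: it is `R`-linear in each vector field. -/
def covTorsionHom (D : Connection k R) :
    Derivation k R R →ₗ[R] Derivation k R R →ₗ[R] Derivation k R R →ₗ[R] Derivation k R R where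
  toFun X := LinearMap.mk₂ R (D.covTorsion X)
    (fun Y Y' Z => by
      simp only [covTorsion, map_add, torsion_add_left]
      abel)
    (fun f Y Z => by
      simp only [covTorsion, torsion_smul_left, D.leibniz, torsion_add_left, smul_sub]
      abel)
    (fun Y Z Z' => by
      simp only [covTorsion, map_add, torsion_add_right]
      abel)
    (fun f Y Z => by
      simp only [covTorsion, torsion_smul_right, D.leibniz, torsion_add_right, smul_sub]
      abel)
  map_add' X X' := by
    ext1 Y
    ext1 Z
    simp only [LinearMap.mk₂_apply, LinearMap.add_apply, covTorsion, map_add, torsion_add_left,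
      torsion_add_right]
    abel
  map_smul' f X := by
    ext1 Y
    ext1 Z
    simp only [LinearMap.mk₂_apply, LinearMap.smul_apply, covTorsion, map_smul, torsion_smul_left,
      torsion_smul_right, smul_sub, RingHom.id_apply]

theorem covTorsionHom_apply (D : Connection k R) (X Y Z : Derivation k R R) :
    D.covTorsionHom X Y Z = D.covTorsion X Y Z := rfl

theorem torsion_of_isHorizontal {D : Connection k R} {Y Z : Derivation k R R}
    (hY : D.IsHorizontal Y) (hZ : D.IsHorizontal Z) : D.torsion Y Z = -⁅Y, Z⁆ := by
  rw [torsion, hZ Y, hY Z]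
  simp

theorem covTorsion_of_isHorizontal {D : Connection k R} {Y Z : Derivation k R R}
    (hY : D.IsHorizontal Y) (hZ : D.IsHorizontal Z) (X : Derivation k R R) :
    D.covTorsion X Y Z = -D.cov X ⁅Y, Z⁆ := by
  rw [covTorsion, hY X, hZ X, torsion_of_isHorizontal hY hZ]
  have hleft : D.torsion 0 Z = 0 := by simpa using D.torsion_smul_left 0 0 Z
  have hright : D.torsion Y 0 = 0 := by simpa using D.torsion_smul_right 0 Y 0
  rw [hleft, hright, map_neg, sub_zero, sub_zero]

theorem HasParallelTorsion.isHorizontal_lie {D : Connection k R} (h : D.HasParallelTorsion)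
    {Y Z : Derivation k R R} (hY : D.IsHorizontal Y) (hZ : D.IsHorizontal Z) :
    D.IsHorizontal ⁅Y, Z⁆ := by
  intro X
  have := covTorsion_of_isHorizontal hY hZ X
  rw [h] at this
  exact neg_eq_zero.mp this.symm

theorem hasParallelTorsion_of_span {D : Connection k R} {s : Set (Derivation k R R)}
    (hs : Submodule.span R s = ⊤)
    (h : ∀ X ∈ s, ∀ Y ∈ s, ∀ Z ∈ s, D.covTorsion X Y Z = 0) : D.HasParallelTorsion := by
  have : D.covTorsionHom = 0 := by
    refine LinearMap.ext_on hs fun X hX => ?_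
    refine LinearMap.ext_on hs fun Y hY => ?_
    exact LinearMap.ext_on hs fun Z hZ => h X hX Y hY Z hZ
  intro X Y Z
  rw [← covTorsionHom_apply, this]
  rfl

theorem hasParallelTorsion_of_lie {D : Connection k R}
    (hs : Submodule.span R {Y | D.IsHorizontal Y} = ⊤)
    (h : ∀ Y Z, D.IsHorizontal Y → D.IsHorizontal Z → D.IsHorizontal ⁅Y, Z⁆) :
    D.HasParallelTorsion :=
  hasParallelTorsion_of_span hs fun X _ Y hY Z hZ => by
    rw [covTorsion_of_isHorizontal hY hZ, h Y Z hY hZ X, neg_zero]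

end Connection

end Algebra

/-- Conjugation of a derivation by an isomorphism of algebras: the transport of a vector field. -/
def conjDerivation {k R S : Type*} [CommRing k] [CommRing R] [CommRing S] [Algebra k R]
    [Algebra k S] (e : R ≃ₐ[k] S) (X : Derivation k R R) : Derivation k S S :=
  Derivation.mk' (e.toLinearMap ∘ₗ X.toLinearMap ∘ₗ e.symm.toLinearMap) fun a b => by
    simp [X.leibniz]

theorem conjDerivation_apply {k R S : Type*} [CommRing k] [CommRing R] [CommRing S] [Algebra k R]
    [Algebra k S] (e : R ≃ₐ[k] S) (X : Derivation k R R) (s : S) :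
    conjDerivation e X s = e (X (e.symm s)) := rfl

theorem derivation_sum_apply {k R ι : Type*} [CommRing k] [CommRing R] [Algebra k R]
    (s : Finset ι) (X : ι → Derivation k R R) (f : R) : (∑ i ∈ s, X i) f = ∑ i ∈ s, X i f := by
  rw [← Derivation.coeFnAddMonoidHom_apply, map_sum, Finset.sum_apply]
  rfl

/-- A coordinate system in an algebra of functions `R`: functions `coord i` and vector fields
`pderiv i` dual to each other, such that a vector field is determined by its effect on the
coordinates. It is used both for rational functions and for germs of analytic functions. -/
structure Coordinates (k R κ : Type*) [CommRing k] [CommRing R] [Algebra k R] [DecidableEq κ] where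
  coord : κ → R
  pderiv : κ → Derivation k R R
  pderiv_coord : ∀ i j, pderiv i (coord j) = if i = j then 1 else 0
  derivation_eq_zero : ∀ X : Derivation k R R, (∀ i, X (coord i) = 0) → X = 0

namespace Coordinates

variable {k R S κ : Type*} [CommRing k] [CommRing R] [Algebra k R] [CommRing S] [Algebra k S]
  [DecidableEq κ]

/-- Transport of coordinates along an isomorphism of algebras. -/
def map (C : Coordinates k R κ) (e : R ≃ₐ[k] S) : Coordinates k S κ where
  coord i := e (C.coord i)
  pderiv i := conjDerivation e (C.pderiv i)
  pderiv_coord i j := by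
    rw [conjDerivation_apply, e.symm_apply_apply, C.pderiv_coord, apply_ite e, map_one, map_zero]
  derivation_eq_zero X hX := by
    have h : conjDerivation e.symm X = 0 := C.derivation_eq_zero _ fun i => by
      rw [conjDerivation_apply, AlgEquiv.symm_symm, hX, map_zero]
    ext s
    simpa [conjDerivation_apply] using congrArg e (DFunLike.congr_fun h (e.symm s))

variable (C : Coordinates k R κ)

theorem derivation_ext {X Y : Derivation k R R} (h : ∀ i, X (C.coord i) = Y (C.coord i)) :
    X = Y := by
  refine sub_eq_zero.mp (C.derivation_eq_zero _ fun i => ?_)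
  rw [Derivation.sub_apply, h, sub_self]

theorem lie_pderiv (i j : κ) : ⁅C.pderiv i, C.pderiv j⁆ = 0 := by
  refine C.derivation_eq_zero _ fun l => ?_
  rw [Derivation.commutator_apply, C.pderiv_coord, C.pderiv_coord]
  split_ifs <;> simp

/-- The Christoffel symbols `Γ i a b` of a connection: `∇_{∂ i} (∂ b) = ∑ a, Γ i a b • ∂ a`. -/
def christoffel (E : Connection k R) (i : κ) : Matrix κ κ R :=
  Matrix.of fun a b => E.cov (C.pderiv i) (C.pderiv b) (C.coord a)

variable [Fintype κ]

/-- The system `∂ i u = -Γ i u` is flat (completely integrable) if its curvature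
`∂ i (Γ j) - ∂ j (Γ i) + [Γ i, Γ j]` vanishes. -/
def IsFlatSystem (Γ : κ → Matrix κ κ R) : Prop :=
  ∀ i j, (Γ j).map (C.pderiv i) - (Γ i).map (C.pderiv j) + (Γ i * Γ j - Γ j * Γ i) = 0

/-- Every flat linear system has an invertible matrix of solutions: this is the Frobenius theorem
for linear systems in the ring `R`. -/
def HasFundamentalSolutions : Prop :=
  ∀ Γ : κ → Matrix κ κ R, C.IsFlatSystem Γ →
    ∃ U : Matrix κ κ R, IsUnit U.det ∧ ∀ i, U.map (C.pderiv i) = -(Γ i * U)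

variable {C} in
theorem HasFundamentalSolutions.map (hC : C.HasFundamentalSolutions) (e : R ≃ₐ[k] S) :
    (C.map e).HasFundamentalSolutions := by
  intro Γ hΓ
  obtain ⟨U, hU, h⟩ := hC (fun i => (Γ i).map e.symm) fun i j => by
    ext a b
    simpa [Coordinates.map, conjDerivation_apply, Matrix.mul_apply] using
      congrArg e.symm (congrFun₂ (hΓ i j) a b)
  refine ⟨U.map e, ?_, fun i => ?_⟩
  · rw [show (U.map e).det = e U.det from (AlgEquiv.map_det e U).symm]
    exact hU.map e
  · ext a b
    simpa [Coordinates.map, conjDerivation_apply, Matrix.mul_apply] using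
      congrArg e (congrFun₂ (h i) a b)

theorem sum_smul_pderiv_coord (f : κ → R) (j : κ) :
    (∑ i, f i • C.pderiv i) (C.coord j) = f j := by
  rw [derivation_sum_apply]
  simp [C.pderiv_coord]

theorem derivation_eq_sum (X : Derivation k R R) : X = ∑ i, X (C.coord i) • C.pderiv i :=
  C.derivation_ext fun j => (C.sum_smul_pderiv_coord (fun i => X (C.coord i)) j).symm

theorem span_pderiv : Submodule.span R (Set.range C.pderiv) = ⊤ := by
  refine eq_top_iff.mpr fun X _ => ?_
  rw [C.derivation_eq_sum X]
  exact Submodule.sum_mem _ fun i _ =>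
    Submodule.smul_mem _ _ (Submodule.subset_span (Set.mem_range_self i))

theorem isHorizontal_iff (E : Connection k R) (Y : Derivation k R R) :
    E.IsHorizontal Y ↔ ∀ i, E.cov (C.pderiv i) Y = 0 := by
  refine ⟨fun h i => h _, fun h X => ?_⟩
  rw [C.derivation_eq_sum X]
  simp [h]

theorem cov_pderiv_coord (E : Connection k R) (i : κ) (Y : Derivation k R R) (a : κ) :
    E.cov (C.pderiv i) Y (C.coord a) =
      C.pderiv i (Y (C.coord a)) + ∑ b, C.christoffel E i a b * Y (C.coord b) := by
  conv_lhs => rw [C.derivation_eq_sum Y]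
  simp only [map_sum, derivation_sum_apply, E.leibniz, Derivation.add_apply, Derivation.smul_apply,
    C.pderiv_coord, smul_eq_mul, mul_ite, mul_one, mul_zero, Finset.sum_add_distrib,
    Finset.sum_ite_eq', Finset.mem_univ, if_true, mul_comm (Y _)]
  rfl

theorem cov_coord (E : Connection k R) (X Y : Derivation k R R) (a : κ) :
    E.cov X Y (C.coord a) =
      X (Y (C.coord a)) +
        ∑ i, ∑ b, X (C.coord i) * (C.christoffel E i a b * Y (C.coord b)) := by
  have hX : X (Y (C.coord a)) = ∑ i, X (C.coord i) * C.pderiv i (Y (C.coord a)) := by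
    conv_lhs => rw [C.derivation_eq_sum X]
    rw [derivation_sum_apply]
    rfl
  conv_lhs => rw [C.derivation_eq_sum X]
  rw [map_sum, LinearMap.sum_apply, derivation_sum_apply, hX, ← Finset.sum_add_distrib]
  refine Finset.sum_congr rfl fun i _ => ?_
  rw [map_smul, LinearMap.smul_apply, Derivation.smul_apply, C.cov_pderiv_coord, smul_eq_mul,
    mul_add, Finset.mul_sum]

theorem curvature_pderiv_coord (E : Connection k R) (i j a b : κ) :
    E.curvature (C.pderiv i) (C.pderiv j) (C.pderiv b) (C.coord a) =
      ((C.christoffel E j).map (C.pderiv i) - (C.christoffel E i).map (C.pderiv j) +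
        (C.christoffel E i * C.christoffel E j - C.christoffel E j * C.christoffel E i)) a b := by
  have h : ∀ i j, E.cov (C.pderiv i) (E.cov (C.pderiv j) (C.pderiv b)) (C.coord a) =
      C.pderiv i (C.christoffel E j a b) + (C.christoffel E i * C.christoffel E j) a b :=
    fun i j => C.cov_pderiv_coord E i _ a
  rw [Connection.curvature, C.lie_pderiv, map_zero, LinearMap.zero_apply, sub_zero,
    Derivation.sub_apply, h, h]
  simp only [Matrix.add_apply, Matrix.sub_apply, Matrix.map_apply]
  ring

variable {C} in
/- The columns of a fundamental matrix of the Christoffel system are horizontal fields; its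
invertibility means that they form a frame. -/
theorem HasFundamentalSolutions.span_isHorizontal (hC : C.HasFundamentalSolutions)
    {E : Connection k R}
    (hE : ∀ i j b, E.curvature (C.pderiv i) (C.pderiv j) (C.pderiv b) = 0) :
    Submodule.span R {Y | E.IsHorizontal Y} = ⊤ := by
  obtain ⟨U, hU, h⟩ := hC (C.christoffel E) fun i j => by
    ext a b
    rw [← C.curvature_pderiv_coord, hE]
    rfl
  have hY : ∀ b, E.IsHorizontal (∑ a, U a b • C.pderiv a) := by
    intro b
    rw [C.isHorizontal_iff]
    refine fun i => C.derivation_eq_zero _ fun a => ?_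
    simp only [C.cov_pderiv_coord, C.sum_smul_pderiv_coord]
    exact add_eq_zero_iff_eq_neg.mpr (congrFun₂ (h i) a b)
  have hU' : ∀ c, C.pderiv c = ∑ b, U⁻¹ b c • ∑ a, U a b • C.pderiv a := by
    refine fun c => C.derivation_ext fun j => ?_
    have := congrFun₂ (Matrix.mul_nonsing_inv U hU) j c
    simp only [derivation_sum_apply, Derivation.smul_apply, C.sum_smul_pderiv_coord,
      C.pderiv_coord, smul_eq_mul, mul_comm (U⁻¹ _ _)]
    rw [if_congr eq_comm rfl rfl, ← Matrix.one_apply, ← this, Matrix.mul_apply]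
  rw [eq_top_iff, ← C.span_pderiv, Submodule.span_le]
  rintro _ ⟨c, rfl⟩
  rw [hU' c]
  exact Submodule.sum_mem _ fun b _ => Submodule.smul_mem _ _ (Submodule.subset_span (hY b))

/-- The connection with given Christoffel symbols. -/
def connection (Γ : κ → Matrix κ κ R) : Connection k R where
  cov := LinearMap.mk₂' R k
    (fun X Y => ∑ a, (X (Y (C.coord a)) + ∑ i, ∑ b, X (C.coord i) * (Γ i a b * Y (C.coord b))) •
      C.pderiv a)
    (fun X X' Y => by
      simp only [Derivation.add_apply, ← Finset.sum_add_distrib, add_mul, ← add_smul]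
      simp only [Finset.sum_add_distrib, add_add_add_comm])
    (fun f X Y => by
      simp only [Derivation.smul_apply, Finset.smul_sum, smul_smul, smul_eq_mul, mul_add,
        Finset.mul_sum, mul_assoc])
    (fun X Y Y' => by
      simp only [Derivation.add_apply, ← Finset.sum_add_distrib, mul_add, ← add_smul, map_add]
      simp only [Finset.sum_add_distrib, add_add_add_comm])
    (fun c X Y => by
      simp only [Derivation.smul_apply, Finset.smul_sum, X.map_smul, mul_smul_comm, smul_add,
        ← smul_assoc])
  leibniz X Y f := by
    refine C.derivation_ext fun j => ?_
    simp only [LinearMap.mk₂'_apply, Derivation.add_apply, Derivation.smul_apply,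
      C.sum_smul_pderiv_coord, smul_eq_mul, Derivation.leibniz, mul_add, Finset.mul_sum,
      mul_left_comm _ f]
    ring

theorem connection_cov_coord (Γ : κ → Matrix κ κ R) (X Y : Derivation k R R) (a : κ) :
    (C.connection Γ).cov X Y (C.coord a) =
      X (Y (C.coord a)) + ∑ i, ∑ b, X (C.coord i) * (Γ i a b * Y (C.coord b)) :=
  C.sum_smul_pderiv_coord (fun a => X (Y (C.coord a)) +
    ∑ i, ∑ b, X (C.coord i) * (Γ i a b * Y (C.coord b))) a

end Coordinates

section Germs

variable {A : Type*} [CommRing A] [Algebra ℂ A]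

/-- Taking the germ at `x` of a regular function, as a morphism of algebras. -/
def regularGermHom (x : Point A) : A →ₐ[ℂ] AnalyticGerm x where
  toFun := regularGerm x
  map_one' := Subtype.ext (congrArg Germ.ofFun (funext fun y => map_one y.eval))
  map_mul' a b := Subtype.ext (congrArg Germ.ofFun (funext fun y => map_mul y.eval a b))
  map_zero' := Subtype.ext (congrArg Germ.ofFun (funext fun y => map_zero y.eval))
  map_add' a b := Subtype.ext (congrArg Germ.ofFun (funext fun y => map_add y.eval a b))
  commutes' c := by
    refine Subtype.ext ?_
    rw [Subalgebra.coe_algebraMap, Algebra.algebraMap_eq_smul_one (A := Germ (𝓝 x) ℂ)]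
    refine congrArg Germ.ofFun (funext fun y => ?_)
    change y.eval _ = c * 1
    rw [y.eval.commutes, mul_one]
    rfl

theorem regularGermHom_apply (x : Point A) (a : A) : regularGermHom x a = regularGerm x a := rfl

variable {K : Type*} [Field K] [Algebra A K]

namespace IsFunctionGerm

variable {x : Point A} {f f' : K} {g g' : AnalyticGerm x}

theorem regular (a : A) : IsFunctionGerm x (algebraMap A K a) (regularGerm x a) := by
  refine ⟨a, 1, by simp, by simp, ?_⟩
  rw [← regularGermHom_apply x 1, map_one, mul_one]

theorem add (h : IsFunctionGerm x f g) (h' : IsFunctionGerm x f' g') :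
    IsFunctionGerm x (f + f') (g + g') := by
  obtain ⟨b, c, hc, h1, h2⟩ := h
  obtain ⟨b', c', hc', h1', h2'⟩ := h'
  refine ⟨b * c' + b' * c, c * c', by simpa using ⟨hc, hc'⟩, ?_, ?_⟩
  · simp only [map_add, map_mul, ← h1, ← h1']
    ring
  · simp only [← regularGermHom_apply, map_add, map_mul] at *
    rw [← h2, ← h2']
    ring

theorem mul (h : IsFunctionGerm x f g) (h' : IsFunctionGerm x f' g') :
    IsFunctionGerm x (f * f') (g * g') := by
  obtain ⟨b, c, hc, h1, h2⟩ := h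
  obtain ⟨b', c', hc', h1', h2'⟩ := h'
  refine ⟨b * b', c * c', by simpa using ⟨hc, hc'⟩, ?_, ?_⟩
  · simp only [map_mul, ← h1, ← h1']
    ring
  · simp only [← regularGermHom_apply, map_mul] at *
    rw [← h2, ← h2']
    ring

theorem neg (h : IsFunctionGerm x f g) : IsFunctionGerm x (-f) (-g) := by
  obtain ⟨b, c, hc, h1, h2⟩ := h
  refine ⟨-b, c, hc, by rw [map_neg, ← h1, neg_mul], ?_⟩
  simp only [← regularGermHom_apply, map_neg] at *
  rw [← h2]
  ring

theorem sub (h : IsFunctionGerm x f g) (h' : IsFunctionGerm x f' g') :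
    IsFunctionGerm x (f - f') (g - g') := by
  rw [sub_eq_add_neg, sub_eq_add_neg]
  exact h.add h'.neg

theorem zero : IsFunctionGerm x (0 : K) 0 := by
  have := regular (K := K) (x := x) 0
  rwa [map_zero, ← regularGermHom_apply, map_zero] at this

theorem sum {ι : Type*} (s : Finset ι) {f : ι → K} {g : ι → AnalyticGerm x}
    (h : ∀ i ∈ s, IsFunctionGerm x (f i) (g i)) :
    IsFunctionGerm x (∑ i ∈ s, f i) (∑ i ∈ s, g i) := by
  classical
  induction s using Finset.induction_on with
  | empty => simpa using zero
  | insert i s hi ih =>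
    rw [Finset.sum_insert hi, Finset.sum_insert hi]
    exact (h i (Finset.mem_insert_self i s)).add
      (ih fun j hj => h j (Finset.mem_insert_of_mem hj))

theorem of_mul_regular {c : A} (hc : algebraMap A K c ≠ 0)
    (h : IsFunctionGerm x (f * algebraMap A K c) (g * regularGerm x c)) :
    IsFunctionGerm x f g := by
  obtain ⟨b, e, he, h1, h2⟩ := h
  refine ⟨b, c * e, by simpa using ⟨hc, he⟩, ?_, ?_⟩
  · rw [map_mul, ← h1, mul_assoc]
  · simp only [← regularGermHom_apply, map_mul] at *
    rw [← h2, mul_assoc]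

theorem derivation [Algebra ℂ K] {X : Derivation ℂ K K}
    {V : Derivation ℂ (AnalyticGerm x) (AnalyticGerm x)}
    (hX : IsFieldGerm x X V) (h : IsFunctionGerm x f g) : IsFunctionGerm x (X f) (V g) := by
  have hfg := h
  obtain ⟨b, c, hc, h1, h2⟩ := h
  refine of_mul_regular hc ?_
  have e1 : X f * algebraMap A K c = X (algebraMap A K b) - f * X (algebraMap A K c) := by
    rw [← h1, X.leibniz, smul_eq_mul, smul_eq_mul]
    ring
  have e2 : V g * regularGerm x c = V (regularGerm x b) - g * V (regularGerm x c) := by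
    rw [← h2, V.leibniz, smul_eq_mul, smul_eq_mul]
    ring
  rw [e1, e2]
  exact (hX b).sub (hfg.mul (hX c))

end IsFunctionGerm

namespace IsFieldGerm

variable [Algebra ℂ K] {x : Point A} {X Y : Derivation ℂ K K}
  {V W : Derivation ℂ (AnalyticGerm x) (AnalyticGerm x)}

theorem add (hX : IsFieldGerm x X V) (hY : IsFieldGerm x Y W) : IsFieldGerm x (X + Y) (V + W) :=
  fun a => (hX a).add (hY a)

theorem sub (hX : IsFieldGerm x X V) (hY : IsFieldGerm x Y W) : IsFieldGerm x (X - Y) (V - W) :=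
  fun a => (hX a).sub (hY a)

theorem smul {f : K} {g : AnalyticGerm x} (h : IsFunctionGerm x f g) (hX : IsFieldGerm x X V) :
    IsFieldGerm x (f • X) (g • V) :=
  fun a => h.mul (hX a)

theorem zero :
    IsFieldGerm x (0 : Derivation ℂ K K) (0 : Derivation ℂ (AnalyticGerm x) (AnalyticGerm x)) :=
  fun _ => IsFunctionGerm.zero

theorem sum {ι : Type*} (s : Finset ι) {X : ι → Derivation ℂ K K}
    {V : ι → Derivation ℂ (AnalyticGerm x) (AnalyticGerm x)}
    (h : ∀ i ∈ s, IsFieldGerm x (X i) (V i)) :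
    IsFieldGerm x (∑ i ∈ s, X i) (∑ i ∈ s, V i) := by
  classical
  induction s using Finset.induction_on with
  | empty => simpa using zero
  | insert i s hi ih =>
    rw [Finset.sum_insert hi, Finset.sum_insert hi]
    exact (h i (Finset.mem_insert_self i s)).add
      (ih fun j hj => h j (Finset.mem_insert_of_mem hj))

theorem lie (hX : IsFieldGerm x X V) (hY : IsFieldGerm x Y W) :
    IsFieldGerm x ⁅X, Y⁆ ⁅V, W⁆ := fun a => by
  rw [Derivation.commutator_apply, Derivation.commutator_apply]
  exact ((hY a).derivation hX).sub ((hX a).derivation hY)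

end IsFieldGerm

namespace IsConnectionGerm

variable [Algebra ℂ K] {x : Point A} {D : Connection ℂ K} {E : Connection ℂ (AnalyticGerm x)}
  {X Y Z : Derivation ℂ K K} {U V W : Derivation ℂ (AnalyticGerm x) (AnalyticGerm x)}

theorem torsion (h : IsConnectionGerm x D E) (hX : IsFieldGerm x X U) (hY : IsFieldGerm x Y V) :
    IsFieldGerm x (D.torsion X Y) (E.torsion U V) :=
  ((h _ _ _ _ hX hY).sub (h _ _ _ _ hY hX)).sub (hX.lie hY)

theorem covTorsion (h : IsConnectionGerm x D E) (hX : IsFieldGerm x X U) (hY : IsFieldGerm x Y V)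
    (hZ : IsFieldGerm x Z W) : IsFieldGerm x (D.covTorsion X Y Z) (E.covTorsion U V W) :=
  ((h _ _ _ _ hX (h.torsion hY hZ)).sub (h.torsion (h _ _ _ _ hX hY) hZ)).sub
    (h.torsion hY (h _ _ _ _ hX hZ))

theorem curvature (h : IsConnectionGerm x D E) (hX : IsFieldGerm x X U) (hY : IsFieldGerm x Y V)
    (hZ : IsFieldGerm x Z W) : IsFieldGerm x (D.curvature X Y Z) (E.curvature U V W) :=
  ((h _ _ _ _ hX (h _ _ _ _ hY hZ)).sub (h _ _ _ _ hY (h _ _ _ _ hX hZ))).sub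
    (h _ _ _ _ (hX.lie hY) hZ)

end IsConnectionGerm

end Germs

section RayTransport

open unitInterval

variable {E G M : Type*} [NormedAddCommGroup E] [NormedSpace ℂ E] [NormedAddCommGroup G]
  [NormedSpace ℂ G] [NormedRing M] [NormedAlgebra ℂ M]

theorem eventually_forall_smul_of_eventually {p : E → Prop} (hp : ∀ᶠ z in 𝓝 (0 : E), p z) :
    ∀ᶠ z in 𝓝 (0 : E), ∀ t ∈ I, p (t • z) := by
  obtain ⟨δ, hδ, hball⟩ := Metric.eventually_nhds_iff_ball.mp hp
  refine Metric.eventually_nhds_iff_ball.mpr ⟨δ, hδ, fun z hz t ht => hball _ ?_⟩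
  exact (convex_ball (0 : E) δ).smul_mem_of_zero_mem (Metric.mem_ball_self hδ) hz ht

variable (G) in
/-- The map sending `g` to the path `t ↦ tⁿ g`. -/
def monomialCLM (n : ℕ) : G →L[ℂ] C(I, G) :=
  LinearMap.mkContinuous
    { toFun := fun g => ⟨fun t => (t : ℝ) ^ n • g, by fun_prop⟩
      map_add' := fun g h => ContinuousMap.ext fun t => smul_add _ g h
      map_smul' := fun a g => ContinuousMap.ext fun t => smul_comm _ a g } 1 fun g => by
    rw [one_mul, ContinuousMap.norm_le _ (norm_nonneg g)]
    intro t
    change ‖(t : ℝ) ^ n • g‖ ≤ ‖g‖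
    rw [norm_smul, norm_pow, Real.norm_of_nonneg t.2.1]
    exact mul_le_of_le_one_left (norm_nonneg g) (pow_le_one₀ t.2.1 t.2.2)

theorem norm_monomialCLM_le (n : ℕ) : ‖monomialCLM G n‖ ≤ 1 :=
  LinearMap.mkContinuous_norm_le _ zero_le_one _

/- The `n`-th term of the power series of `f` is homogeneous of degree `n`, so the power series of
`z ↦ (t ↦ f (t • z))` is obtained by multiplying its `n`-th term by the path `t ↦ tⁿ`. -/
theorem exists_analyticAt_ray [CompleteSpace G] {f : E → G} (hf : AnalyticAt ℂ f 0) :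
    ∃ γ : E → C(I, G), AnalyticAt ℂ γ 0 ∧ ∀ᶠ z in 𝓝 (0 : E), ∀ t : I, γ z t = f ((t : ℝ) • z) := by
  obtain ⟨q, r, hq⟩ := hf
  let q' : FormalMultilinearSeries ℂ E C(I, G) := fun n =>
    (monomialCLM G n).compContinuousMultilinearMap (q n)
  have hrad : q.radius ≤ q'.radius := FormalMultilinearSeries.radius_le_of_le fun n =>
    ((monomialCLM G n).norm_compContinuousMultilinearMap_le (q n)).trans
      (mul_le_of_le_one_left (norm_nonneg _) (norm_monomialCLM_le n))
  have hpos : 0 < q'.radius := (hq.r_pos.trans_le hq.r_le).trans_le hrad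
  have hq' := q'.hasFPowerSeriesOnBall hpos
  refine ⟨q'.sum, hq'.analyticAt, ?_⟩
  filter_upwards [Metric.eball_mem_nhds 0 hpos,
    eventually_forall_smul_of_eventually (Metric.eball_mem_nhds (0 : E) hq.r_pos)] with z hz hz' t
  have hγ := (ContinuousMap.evalCLM ℂ t).hasSum (hq'.hasSum hz)
  have hf := hq.hasSum (hz' t t.2)
  rw [zero_add] at hγ hf
  refine hγ.unique (hf.congr_fun fun n => ?_)
  have hterm : q n (fun _ => (t : ℝ) • z) = (t : ℝ) ^ n • q n fun _ => z := by
    simpa using ((q n).restrictScalars ℝ).map_smul_univ (fun _ => (t : ℝ)) fun _ => z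
  exact hterm.symm

/-- `y` solves the linear differential equation `y' = -γ y` on the unit interval: parallel
transport for the connection form `γ dt`. -/
def IsParallel (γ y : ℝ → M) : Prop :=
  ∀ t ∈ I, HasDerivWithinAt y (-(γ t * y t)) I t

theorem IsParallel.comp_mul_left {γ y : ℝ → M} (hy : IsParallel γ y) {s : ℝ} (hs : s ∈ I) :
    IsParallel (fun t => s • γ (s * t)) fun t => y (s * t) := by
  intro t ht
  have hmaps : Set.MapsTo (fun t : ℝ => s * t) I I := fun r hr => unitInterval.mul_mem hs hr
  have hmul : HasDerivWithinAt (fun t : ℝ => s * t) s I t := by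
    simpa using ((hasDerivAt_id t).const_mul s).hasDerivWithinAt
  refine ((hy (s * t) (hmaps ht)).scomp t hmul hmaps).congr_deriv ?_
  rw [smul_neg, smul_mul_assoc]

theorem IsParallel.eqOn {γ y y' : ℝ → M} (hγ : ContinuousOn γ I) (hy : IsParallel γ y)
    (hy' : IsParallel γ y') (h0 : y 0 = y' 0) : Set.EqOn y y' I := by
  obtain ⟨K, hK⟩ := isCompact_Icc.exists_bound_of_continuousOn hγ
  have hright : ∀ {y : ℝ → M}, IsParallel γ y → ∀ t ∈ Set.Ico (0 : ℝ) 1,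
      HasDerivWithinAt y (-(γ t * y t)) (Set.Ici t) t := fun hy t ht =>
    (hy t ⟨ht.1, ht.2.le⟩).mono_of_mem_nhdsWithin
      (Filter.mem_of_superset (Icc_mem_nhdsGE ht.2) (Set.Icc_subset_Icc_left ht.1))
  refine ODE_solution_unique_of_mem_Icc_right (v := fun t m => -(γ t * m)) (s := fun _ => Set.univ)
    (K := K.toNNReal) (fun t ht => LipschitzOnWith.of_dist_le_mul fun m _ m' _ => ?_)
    (fun t ht => (hy t ht).continuousWithinAt) (hright hy) (fun _ _ => Set.mem_univ _)
    (fun t ht => (hy' t ht).continuousWithinAt) (hright hy') (fun _ _ => Set.mem_univ _) h0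
  rw [dist_neg_neg, dist_eq_norm, ← mul_sub, dist_eq_norm]
  refine (norm_mul_le _ _).trans (mul_le_mul_of_nonneg_right ?_ (norm_nonneg _))
  exact (hK t ⟨ht.1, ht.2.le⟩).trans (Real.le_coe_toNNReal K)

variable (M) in
/-- Integration from `0`, as an operator on paths. -/
def primitive : C(I, M) →L[ℂ] C(I, M) :=
  LinearMap.mkContinuous
    { toFun := fun c => ⟨fun t => ∫ s in (0 : ℝ)..t, Set.IccExtend zero_le_one c s,
        (intervalIntegral.continuous_primitive
          (fun a b => c.continuous.Icc_extend'.intervalIntegrable a b) 0).comp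
            continuous_subtype_val⟩
      map_add' := fun c d => ContinuousMap.ext fun t =>
        intervalIntegral.integral_add (c.continuous.Icc_extend'.intervalIntegrable _ _)
          (d.continuous.Icc_extend'.intervalIntegrable _ _)
      map_smul' := fun a c => ContinuousMap.ext fun t => intervalIntegral.integral_smul a _ }
    1 fun c => by
      rw [one_mul, ContinuousMap.norm_le _ (norm_nonneg c)]
      intro t
      refine (intervalIntegral.norm_integral_le_of_norm_le_const
        (C := ‖c‖) fun s _ => c.norm_coe_le_norm _).trans ?_
      rw [sub_zero, abs_of_nonneg t.2.1]
      exact mul_le_of_le_one_right (norm_nonneg c) t.2.2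

/-- The Volterra operator of a path `γ`, namely `c ↦ (t ↦ ∫ s in 0..t, γ s * c s)`. -/
def volterra (γ : C(I, M)) : C(I, M) →L[ℂ] C(I, M) :=
  (primitive M).comp (ContinuousLinearMap.mul ℂ C(I, M) γ)

theorem isBoundedLinearMap_volterra : IsBoundedLinearMap ℂ (volterra (M := M)) :=
  IsLinearMap.with_bound
    { map_add γ γ' := by simp only [volterra, map_add, ContinuousLinearMap.comp_add]
      map_smul a γ := by simp only [volterra, map_smul, ContinuousLinearMap.comp_smul] }
    ‖primitive M‖ fun γ => ((primitive M).opNorm_comp_le _).trans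
      (mul_le_mul_of_nonneg_left (ContinuousLinearMap.opNorm_mul_apply_le ℂ _ γ) (norm_nonneg _))

theorem analyticAt_bilinear_comp {F₁ F₂ F₃ : Type*} [NormedAddCommGroup F₁] [NormedSpace ℂ F₁]
    [NormedAddCommGroup F₂] [NormedSpace ℂ F₂] [NormedAddCommGroup F₃] [NormedSpace ℂ F₃]
    {b : F₁ × F₂ → F₃} (hb : IsBoundedBilinearMap ℂ b) {f : E → F₁} {g : E → F₂} {z : E}
    (hf : AnalyticAt ℂ f z) (hg : AnalyticAt ℂ g z) : AnalyticAt ℂ (fun y => b (f y, g y)) z :=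
  hb.contDiff.contDiffAt.analyticAt.comp₂ hf hg

/-- The path obtained by evaluating a path of linear maps at a vector. -/
def pathApply (φ : C(I, E →L[ℂ] M)) (z : E) : C(I, M) := ⟨fun t => φ t z, by fun_prop⟩

theorem isBoundedBilinearMap_pathApply :
    IsBoundedBilinearMap ℂ fun p : C(I, E →L[ℂ] M) × E => pathApply p.1 p.2 where
  add_left _ _ _ := rfl
  smul_left _ _ _ := rfl
  add_right φ z w := ContinuousMap.ext fun t => map_add (φ t) z w
  smul_right a φ z := ContinuousMap.ext fun t => map_smul (φ t) a z
  bound := ⟨1, one_pos, fun φ z => by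
    rw [one_mul, ContinuousMap.norm_le _ (by positivity)]
    exact fun t => (φ t).le_of_opNorm_le (φ.norm_coe_le_norm t) z⟩

variable [CompleteSpace M]

theorem isParallel_of_add_volterra_eq_one {γ c : C(I, M)} (h : c + volterra γ c = 1) :
    c 0 = 1 ∧ IsParallel (Set.IccExtend zero_le_one γ) (Set.IccExtend zero_le_one c) := by
  have hc : ∀ t : I, c t = 1 - ∫ s in (0 : ℝ)..t, Set.IccExtend zero_le_one (γ * c) s :=
    fun t => eq_sub_of_add_eq (DFunLike.congr_fun h t)
  refine ⟨by simpa using hc 0, fun t ht => ?_⟩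
  have hd := (((γ * c).continuous.Icc_extend' (h := zero_le_one)).integral_hasStrictDerivAt
    0 t).hasDerivAt.const_sub 1
  refine (hd.hasDerivWithinAt (s := I)).congr_of_mem (fun s hs => ?_) ht |>.congr_deriv ?_
  · rw [Set.IccExtend_of_mem _ _ hs, hc ⟨s, hs⟩]
  · simp only [Set.IccExtend_of_mem _ _ ht, ContinuousMap.coe_mul, Pi.mul_apply]

/- Neumann series: `1 + L z` is invertible for `z` near `0`, with inverse analytic in `z`. -/
theorem exists_analyticAt_add_apply_eq {X : Type*} [NormedAddCommGroup X] [NormedSpace ℂ X]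
    [CompleteSpace X] {L : E → X →L[ℂ] X} (hL : AnalyticAt ℂ L 0) (hL0 : L 0 = 0) (x : X) :
    ∃ c : E → X, AnalyticAt ℂ c 0 ∧ c 0 = x ∧ ∀ᶠ z in 𝓝 (0 : E), c z + L z (c z) = x := by
  let T : E → X →L[ℂ] X := fun z => 1 + L z
  have hT : AnalyticAt ℂ T 0 := analyticAt_const.add hL
  have hT0 : T 0 = ((1 : (X →L[ℂ] X)ˣ) : X →L[ℂ] X) := by
    simp only [T, hL0, add_zero, Units.val_one]
  have hinv : AnalyticAt ℂ (fun z => Ring.inverse (T z)) 0 := by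
    refine AnalyticAt.fun_comp (g := Ring.inverse) ?_ hT
    rw [hT0]
    exact analyticAt_inverse _
  refine ⟨fun z => Ring.inverse (T z) x,
    ((ContinuousLinearMap.apply ℂ X x).analyticAt _).comp hinv, ?_, ?_⟩
  · simp only [hT0, Units.val_one, Ring.inverse_one, one_apply_eq_self]
  · have hunit : ∀ᶠ z in 𝓝 (0 : E), IsUnit (T z) := by
      refine hT.continuousAt (Units.isOpen.mem_nhds ?_)
      rw [hT0]
      exact Units.isUnit _
    filter_upwards [hunit] with z hz
    exact DFunLike.congr_fun (Ring.mul_inverse_cancel _ hz) x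

theorem exists_analyticAt_isParallel {Γ : E → E →L[ℂ] M} (hΓ : AnalyticAt ℂ Γ 0) :
    ∃ c : E → C(I, M), AnalyticAt ℂ c 0 ∧ c 0 = 1 ∧ ∀ᶠ z in 𝓝 (0 : E), c z 0 = 1 ∧
      IsParallel (fun t => Γ (t • z) z) (Set.IccExtend zero_le_one (c z)) := by
  obtain ⟨φ, hφ, hφΓ⟩ := exists_analyticAt_ray hΓ
  have hV : AnalyticAt ℂ (fun z => volterra (pathApply (φ z) z)) 0 :=
    isBoundedLinearMap_volterra.contDiff.contDiffAt.analyticAt.fun_comp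
      (analyticAt_bilinear_comp isBoundedBilinearMap_pathApply hφ analyticAt_id)
  have hV0 : volterra (pathApply (φ 0) 0) = 0 := by
    have hzero : pathApply (φ 0) 0 = 0 := ContinuousMap.ext fun t => map_zero (φ 0 t)
    rw [hzero, (isBoundedLinearMap_volterra (M := M)).1.map_zero]
  obtain ⟨c, hc, hc0, hcV⟩ := exists_analyticAt_add_apply_eq hV hV0 1
  refine ⟨c, hc, hc0, ?_⟩
  filter_upwards [hcV, hφΓ] with z hz hzΓ
  obtain ⟨h0, hpar⟩ := isParallel_of_add_volterra_eq_one hz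
  refine ⟨h0, fun t ht => (hpar t ht).congr_deriv ?_⟩
  rw [Set.IccExtend_of_mem _ _ ht]
  exact congrArg (fun L : E →L[ℂ] M => -(L z * _)) (hzΓ ⟨t, ht⟩)

end RayTransport

section Frobenius

open unitInterval

variable {E M : Type*} [NormedAddCommGroup E] [NormedSpace ℂ E] [NormedRing M]
  [NormedAlgebra ℂ M]

theorem hasDerivAt_comp_smul_ray {f : E → M} {f' : E →L[ℂ] M} {s : ℝ} {z : E}
    (hf : HasFDerivAt f f' (s • z)) : HasDerivAt (fun r : ℝ => f (r • z)) (f' z) s := by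
  have hray : HasDerivAt (fun r : ℝ => r • z) z s := by
    simpa using (hasDerivAt_id s).smul_const z
  exact (hf.restrictScalars ℝ).comp_hasDerivAt s hray

theorem hasFDerivAt_covariantDifferential {Γ : E → E →L[ℂ] M} {u : E → M} {z : E}
    (hΓ : DifferentiableAt ℂ Γ z) (hu : DifferentiableAt ℂ u z)
    (hu' : DifferentiableAt ℂ (fderiv ℂ u) z) (v : E) :
    HasFDerivAt (fun z => fderiv ℂ u z v + Γ z v * u z)
      ((fderiv ℂ (fderiv ℂ u) z).flip v +
        (Γ z v • fderiv ℂ u z + ((fderiv ℂ Γ z).flip v).smulRight (u z))) z := by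
  have h1 : HasFDerivAt (fun z => fderiv ℂ u z v) ((fderiv ℂ (fderiv ℂ u) z).flip v) z := by
    simpa using hu'.hasFDerivAt.clm_apply (hasFDerivAt_const v z)
  have h2 : HasFDerivAt (fun z => Γ z v) ((fderiv ℂ Γ z).flip v) z := by
    simpa using hΓ.hasFDerivAt.clm_apply (hasFDerivAt_const v z)
  exact h1.add (h2.mul' hu.hasFDerivAt)

theorem eventually_continuousOn_ray {Γ : E → E →L[ℂ] M}
    (hΓ : ∀ᶠ z in 𝓝 (0 : E), ContinuousAt Γ z) :
    ∀ᶠ z in 𝓝 (0 : E), ContinuousOn (fun t : ℝ => Γ (t • z) z) I := by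
  filter_upwards [eventually_forall_smul_of_eventually hΓ] with z hz t ht
  have hray : ContinuousAt (fun r : ℝ => r • z) t := by fun_prop
  have hΓray : ContinuousAt (fun r : ℝ => Γ (r • z)) t := ContinuousAt.comp (g := Γ) (hz t ht) hray
  exact (hΓray.clm_apply continuousAt_const).continuousWithinAt

/- Rescaling a ray: the transport to time `1` along the ray through `s • z` is the transport to time
`s` along the ray through `z`. -/
theorem eventually_apply_one_eq {Γ : E → E →L[ℂ] M}
    (hΓ : ∀ᶠ z in 𝓝 (0 : E), ContinuousAt Γ z) {c : E → C(I, M)}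
    (hc : ∀ᶠ z in 𝓝 (0 : E), c z 0 = 1 ∧
      IsParallel (fun t => Γ (t • z) z) (Set.IccExtend zero_le_one (c z))) :
    ∀ᶠ z in 𝓝 (0 : E), Set.EqOn (fun s : ℝ => c (s • z) 1) (Set.IccExtend zero_le_one (c z)) I := by
  filter_upwards [hc, eventually_forall_smul_of_eventually
    (hc.and (eventually_continuousOn_ray hΓ))] with z ⟨hz0, hz⟩ hsz s hs
  obtain ⟨⟨hsz0, hszpar⟩, hcont⟩ := hsz s hs
  have hscaled : IsParallel (fun t => Γ (t • s • z) (s • z))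
      fun t => Set.IccExtend zero_le_one (c z) (s * t) := by
    refine Eq.subst (motive := fun γ => IsParallel γ _) (funext fun t => ?_) (hz.comp_mul_left hs)
    rw [(Γ _).map_smul_of_tower, smul_smul, mul_comm]
  have hzero : Set.IccExtend zero_le_one (c (s • z)) 0 =
      Set.IccExtend zero_le_one (c z) (s * 0) := by
    rw [mul_zero, Set.IccExtend_left, Set.IccExtend_left]
    exact hsz0.trans hz0.symm
  have hone := hszpar.eqOn hcont hscaled hzero (Set.right_mem_Icc.mpr zero_le_one)
  simp only [Set.IccExtend_right, mul_one] at hone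
  exact hone

theorem eventually_eq_zero_of_radial {Γ : E → E →L[ℂ] M}
    (hΓ : ∀ᶠ z in 𝓝 (0 : E), ContinuousAt Γ z) {W : E → M}
    (hW : ∀ᶠ z in 𝓝 (0 : E), DifferentiableAt ℂ W z)
    (h : ∀ᶠ z in 𝓝 (0 : E), fderiv ℂ W z z + W z + Γ z z * W z = 0) :
    ∀ᶠ z in 𝓝 (0 : E), W z = 0 := by
  filter_upwards [eventually_forall_smul_of_eventually (hW.and h), eventually_continuousOn_ray hΓ]
    with z hz hcont
  have hpar : IsParallel (fun t => Γ (t • z) z) fun s => s • W (s • z) := by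
    intro s hs
    obtain ⟨hWs, heq⟩ := hz s hs
    have hderiv := (hasDerivAt_id s).fun_smul (hasDerivAt_comp_smul_ray hWs.hasFDerivAt)
    refine hderiv.hasDerivWithinAt.congr_deriv ?_
    rw [id, one_smul, mul_smul_comm, ← smul_mul_assoc, ← (Γ _).map_smul_of_tower,
      ← (fderiv ℂ W _).map_smul_of_tower]
    exact eq_neg_of_add_eq_zero_left heq
  have hpar0 : IsParallel (fun t => Γ (t • z) z) fun _ => 0 := fun t _ => by
    simpa only [mul_zero, neg_zero] using hasDerivWithinAt_const t I (0 : M)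
  simpa using hpar.eqOn hcont hpar0 (zero_smul ℝ _) (Set.right_mem_Icc.mpr zero_le_one)

variable [CompleteSpace M]

/- The derivative of the radial equation in the direction `v`. -/
theorem fderiv_fderiv_of_radial {Γ : E → E →L[ℂ] M} {u : E → M} {z : E}
    (hΓ : DifferentiableAt ℂ Γ z) (hu : AnalyticAt ℂ u z)
    (h : ∀ᶠ y in 𝓝 z, fderiv ℂ u y y = -(Γ y y * u y)) (v : E) :
    fderiv ℂ (fderiv ℂ u) z z v =
      -(Γ z z * fderiv ℂ u z v + (Γ z v + fderiv ℂ Γ z v z) * u z) - fderiv ℂ u z v := by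
  have hleft : HasFDerivAt (fun y => fderiv ℂ u y y)
      (fderiv ℂ u z + (fderiv ℂ (fderiv ℂ u) z).flip z) z := by
    simpa using hu.fderiv.differentiableAt.hasFDerivAt.clm_apply (hasFDerivAt_id z)
  have hdiag : HasFDerivAt (fun y => Γ y y) (Γ z + (fderiv ℂ Γ z).flip z) z := by
    simpa using hΓ.hasFDerivAt.clm_apply (hasFDerivAt_id z)
  have hright := (hdiag.mul' hu.differentiableAt.hasFDerivAt).neg
  have heq := DFunLike.congr_fun (hleft.unique (hright.congr_of_eventuallyEq h)) v
  have hsymm : fderiv ℂ (fderiv ℂ u) z v z = fderiv ℂ (fderiv ℂ u) z z v :=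
    (hu.contDiffAt (n := 2)).isSymmSndFDerivAt (by simp) v z
  rw [← hsymm]
  exact eq_sub_of_add_eq' heq

theorem exists_analyticAt_radial {Γ : E → E →L[ℂ] M} (hΓ : AnalyticAt ℂ Γ 0) :
    ∃ u : E → M, AnalyticAt ℂ u 0 ∧ u 0 = 1 ∧
      ∀ᶠ z in 𝓝 (0 : E), fderiv ℂ u z z = -(Γ z z * u z) := by
  obtain ⟨c, hc, hc0, hpar⟩ := exists_analyticAt_isParallel hΓ
  have hu : AnalyticAt ℂ (fun z => c z 1) 0 :=
    ((ContinuousMap.evalCLM ℂ (1 : I) : C(I, M) →L[ℂ] M).analyticAt (c 0)).comp hc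
  refine ⟨fun z => c z 1, hu, by simp only [hc0, ContinuousMap.one_apply], ?_⟩
  filter_upwards [hpar, eventually_apply_one_eq hΓ.eventually_continuousAt hpar,
    hu.eventually_analyticAt] with z hz hscale huz
  have h1 : (1 : ℝ) ∈ I := Set.right_mem_Icc.mpr zero_le_one
  have hderiv : HasDerivAt (fun s : ℝ => c (s • z) 1) (fderiv ℂ (fun z => c z 1) z z) 1 :=
    hasDerivAt_comp_smul_ray (f := fun z => c z 1)
      ((one_smul ℝ z).symm ▸ huz.differentiableAt.hasFDerivAt)
  have hode := (hz.2 1 h1).congr_of_mem hscale h1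
  simp only [one_smul, Set.IccExtend_of_mem _ _ h1] at hode
  exact (uniqueDiffOn_Icc zero_lt_one 1 h1).eq_deriv _ hderiv.hasDerivWithinAt hode

/- The Frobenius theorem for linear systems. The solution `u` is the transport along rays; flatness
makes the defect `W = ∂ᵥu + Γ(v) u` satisfy a radial equation, which forces `W = 0`. -/
theorem exists_analyticAt_parallel {Γ : E → E →L[ℂ] M} (hΓ : AnalyticAt ℂ Γ 0)
    (hflat : ∀ᶠ z in 𝓝 (0 : E), ∀ v w,
      fderiv ℂ Γ z v w - fderiv ℂ Γ z w v + (Γ z v * Γ z w - Γ z w * Γ z v) = 0) :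
    ∃ u : E → M, AnalyticAt ℂ u 0 ∧ u 0 = 1 ∧
      ∀ v, ∀ᶠ z in 𝓝 (0 : E), fderiv ℂ u z v = -(Γ z v * u z) := by
  obtain ⟨u, hu, hu0, hradial⟩ := exists_analyticAt_radial hΓ
  refine ⟨u, hu, hu0, fun v => ?_⟩
  have hW : ∀ᶠ z in 𝓝 (0 : E), HasFDerivAt (fun z => fderiv ℂ u z v + Γ z v * u z)
      ((fderiv ℂ (fderiv ℂ u) z).flip v +
        (Γ z v • fderiv ℂ u z + ((fderiv ℂ Γ z).flip v).smulRight (u z))) z := by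
    filter_upwards [hu.eventually_analyticAt, hΓ.eventually_analyticAt] with z huz hΓz
    exact hasFDerivAt_covariantDifferential hΓz.differentiableAt huz.differentiableAt
      huz.fderiv.differentiableAt v
  have hdefect : ∀ᶠ z in 𝓝 (0 : E), fderiv ℂ u z v + Γ z v * u z = 0 := by
    refine eventually_eq_zero_of_radial hΓ.eventually_continuousAt
      (hW.mono fun z hz => hz.differentiableAt) ?_
    filter_upwards [hW, hu.eventually_analyticAt, hΓ.eventually_analyticAt, hflat,
      hradial.eventually_nhds] with z hWz huz hΓz hflatz hradialz
    have hcurv := congrArg (· * u z) (hflatz z v)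
    simp only [zero_mul] at hcurv
    rw [hWz.fderiv]
    simp only [add_apply, ContinuousLinearMap.flip_apply, smul_apply,
      ContinuousLinearMap.smulRight_apply, smul_eq_mul]
    rw [fderiv_fderiv_of_radial hΓz.differentiableAt huz hradialz, hradialz.self_of_nhds, ← hcurv]
    noncomm_ring
  exact hdefect.mono fun z hz => eq_neg_of_add_eq_zero_left hz

end Frobenius

section CoordinateSystem

variable {κ M : Type*} [Fintype κ] [NormedRing M] [NormedAlgebra ℂ M]

/-- The connection form `∑ i, f i dzᵢ`. -/
def connectionForm (f : κ → (κ → ℂ) → M) (z : κ → ℂ) : (κ → ℂ) →L[ℂ] M :=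
  ∑ i, ContinuousLinearMap.smulRightL ℂ (κ → ℂ) M (ContinuousLinearMap.proj i) (f i z)

theorem connectionForm_apply (f : κ → (κ → ℂ) → M) (z v : κ → ℂ) :
    connectionForm f z v = ∑ i, v i • f i z := by
  simp [connectionForm]

theorem analyticAt_connectionForm {f : κ → (κ → ℂ) → M} {z : κ → ℂ}
    (hf : ∀ i, AnalyticAt ℂ (f i) z) : AnalyticAt ℂ (connectionForm f) z :=
  Finset.analyticAt_fun_sum _ fun i _ =>
    ((ContinuousLinearMap.smulRightL ℂ (κ → ℂ) M (ContinuousLinearMap.proj i)).analyticAt _).comp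
      (hf i)

variable [DecidableEq κ]

theorem clm_apply_eq_sum_single {G : Type*} [NormedAddCommGroup G] [NormedSpace ℂ G]
    (L : (κ → ℂ) →L[ℂ] G) (v : κ → ℂ) : L v = ∑ i, v i • L (Pi.single i 1) := by
  conv_lhs => rw [pi_eq_sum_univ' v]
  simp only [map_sum, map_smul]

theorem fderiv_connectionForm_apply {f : κ → (κ → ℂ) → M} {z : κ → ℂ}
    (hf : ∀ i, DifferentiableAt ℂ (f i) z) (v w : κ → ℂ) :
    fderiv ℂ (connectionForm f) z v w =
      ∑ i, ∑ j, (v i * w j) • fderiv ℂ (f j) z (Pi.single i 1) := by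
  have h : HasFDerivAt (connectionForm f) (∑ i,
      (ContinuousLinearMap.smulRightL ℂ (κ → ℂ) M (ContinuousLinearMap.proj i)).comp
        (fderiv ℂ (f i) z)) z :=
    HasFDerivAt.fun_sum fun i _ =>
      (ContinuousLinearMap.smulRightL ℂ (κ → ℂ) M (ContinuousLinearMap.proj i)).hasFDerivAt.comp z
        (hf i).hasFDerivAt
  have hsum : fderiv ℂ (connectionForm f) z v w = ∑ j, w j • fderiv ℂ (f j) z v := by
    rw [h.fderiv]
    simp
  rw [hsum, Finset.sum_comm]
  refine Finset.sum_congr rfl fun j _ => ?_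
  rw [clm_apply_eq_sum_single, Finset.smul_sum]
  exact Finset.sum_congr rfl fun i _ => by rw [smul_smul, mul_comm]

theorem exists_analyticAt_parallel_of_coordinates [CompleteSpace M] {f : κ → (κ → ℂ) → M}
    (hf : ∀ i, AnalyticAt ℂ (f i) 0)
    (hflat : ∀ i j, ∀ᶠ z in 𝓝 (0 : κ → ℂ), fderiv ℂ (f j) z (Pi.single i 1) -
      fderiv ℂ (f i) z (Pi.single j 1) + (f i z * f j z - f j z * f i z) = 0) :
    ∃ u : (κ → ℂ) → M, AnalyticAt ℂ u 0 ∧ u 0 = 1 ∧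
      ∀ i, ∀ᶠ z in 𝓝 (0 : κ → ℂ), fderiv ℂ u z (Pi.single i 1) = -(f i z * u z) := by
  obtain ⟨u, hu, hu0, hpar⟩ := exists_analyticAt_parallel (analyticAt_connectionForm hf) <| by
    filter_upwards [eventually_all.mpr fun i => eventually_all.mpr fun j => hflat i j,
      eventually_all.mpr fun i => (hf i).eventually_analyticAt] with z hz hfz v w
    rw [fderiv_connectionForm_apply fun i => (hfz i).differentiableAt,
      fderiv_connectionForm_apply fun i => (hfz i).differentiableAt,
      Finset.sum_comm (f := fun i j => (w i * v j) • _)]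
    simp only [connectionForm_apply, Finset.sum_mul_sum, smul_mul_smul_comm]
    rw [Finset.sum_comm (f := fun i j => (w i * v j) • _)]
    simp only [mul_comm (w _), ← Finset.sum_sub_distrib, ← Finset.sum_add_distrib, ← smul_sub,
      ← smul_add, hz, smul_zero, Finset.sum_const_zero]
  refine ⟨u, hu, hu0, fun i => (hpar (Pi.single i 1)).mono fun z hz => ?_⟩
  rw [hz, connectionForm_apply]
  simp only [Pi.single_apply, ite_smul, one_smul, zero_smul, Finset.sum_ite_eq', Finset.mem_univ,
    if_true]

end CoordinateSystem

section OriginGerm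

/- Dropping the first coefficient of the power series of `F` gives that of `G`. -/
theorem exists_analyticAt_hadamard {E : Type*} [NormedAddCommGroup E] [NormedSpace ℂ E]
    {F : E → ℂ} (hF : AnalyticAt ℂ F 0) :
    ∃ G : E → E →L[ℂ] ℂ, AnalyticAt ℂ G 0 ∧ ∀ᶠ z in 𝓝 (0 : E), F z = F 0 + G z z := by
  obtain ⟨q, r, hq⟩ := hF
  have hpos : 0 < q.shift.radius := by
    rw [q.radius_shift]
    exact hq.r_pos.trans_le hq.r_le
  have hshift := q.shift.hasFPowerSeriesOnBall hpos
  refine ⟨q.shift.sum, hshift.analyticAt, ?_⟩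
  filter_upwards [Metric.eball_mem_nhds (0 : E) hpos, Metric.eball_mem_nhds (0 : E) hq.r_pos]
    with z hz hz'
  have hG := (ContinuousLinearMap.apply ℂ ℂ z).hasSum (hshift.hasSum hz)
  have hF := (hasSum_nat_add_iff' 1).mpr (hq.hasSum hz')
  rw [zero_add] at hG hF
  rw [Finset.sum_range_one, hq.hasFPowerSeriesAt.coeff_zero] at hF
  have hterm : ∀ n : ℕ, (ContinuousLinearMap.apply ℂ ℂ z) (q.shift n fun _ => z) =
      q (n + 1) fun _ => z := by
    intro n
    change q (n + 1) (Fin.snoc (fun _ => z) z) = _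
    congr 1
    ext i
    refine Fin.lastCases ?_ (fun j => ?_) i <;> simp
  simp only [hterm] at hG
  exact sub_eq_iff_eq_add'.mp (hF.unique hG)

theorem analyticAt_clm_apply_const {E F G : Type*} [NormedAddCommGroup E] [NormedSpace ℂ E]
    [NormedAddCommGroup F] [NormedSpace ℂ F] [NormedAddCommGroup G] [NormedSpace ℂ G]
    {f : E → F →L[ℂ] G} {x : E} (hf : AnalyticAt ℂ f x) (v : F) :
    AnalyticAt ℂ (fun z => f z v) x :=
  ((ContinuousLinearMap.apply ℂ G v).analyticAt _).comp hf

theorem eventually_eq_zero_of_forall_line {E : Type*} [NormedAddCommGroup E] [NormedSpace ℂ E]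
    {F : E → ℂ} (hF : AnalyticAt ℂ F 0)
    (h : ∀ z : E, ∀ᶠ t in 𝓝 (0 : ℂ), F (t • z) = 0) : ∀ᶠ z in 𝓝 (0 : E), F z = 0 := by
  obtain ⟨δ, hδ, hball⟩ := Metric.eventually_nhds_iff_ball.mp hF.eventually_analyticAt
  refine Metric.eventually_nhds_iff_ball.mpr ⟨δ, hδ, fun z hz => ?_⟩
  let l : ℂ →L[ℂ] E := (ContinuousLinearMap.id ℂ ℂ).smulRight z
  have hconv : Convex ℝ (l ⁻¹' Metric.ball (0 : E) δ) :=
    (convex_ball (0 : E) δ).linear_preimage (l.restrictScalars ℝ).toLinearMap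
  have han : AnalyticOnNhd ℂ (fun t => F (l t)) (l ⁻¹' Metric.ball (0 : E) δ) := fun t ht =>
    (hball _ ht).comp_of_eq (l.analyticAt t) rfl
  simpa [l] using han.eqOn_zero_of_preconnected_of_eventuallyEq_zero hconv.isPreconnected
    (z₀ := 0) (by simp [hδ]) (h z) (x := 1) (by simpa [l] using hz)

theorem eventually_eq_zero_or_eventually_eq_zero {E : Type*} [NormedAddCommGroup E]
    [NormedSpace ℂ E] {F G : E → ℂ} {x : E} (hF : AnalyticAt ℂ F x) (hG : AnalyticAt ℂ G x)
    (h : ∀ᶠ z in 𝓝 x, F z * G z = 0) : (∀ᶠ z in 𝓝 x, F z = 0) ∨ ∀ᶠ z in 𝓝 x, G z = 0 := by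
  obtain ⟨δ, hδ, hball⟩ := Metric.eventually_nhds_iff_ball.mp
    (h.and (hF.eventually_analyticAt.and hG.eventually_analyticAt))
  simp only [Metric.eventually_nhds_iff_ball]
  refine or_iff_not_imp_left.mpr fun hF0 => ⟨δ, hδ, ?_⟩
  obtain ⟨w, hw, hFw⟩ : ∃ w ∈ Metric.ball x δ, F w ≠ 0 := by
    by_contra! hzero
    exact hF0 ⟨δ, hδ, hzero⟩
  have hGw : G =ᶠ[𝓝 w] 0 := by
    filter_upwards [(hball w hw).2.1.continuousAt.eventually_ne hFw,
      Metric.isOpen_ball.mem_nhds hw] with z hFz hz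
    exact (mul_eq_zero.mp (hball z hz).1).resolve_left hFz
  exact AnalyticOnNhd.eqOn_zero_of_preconnected_of_eventuallyEq_zero
    (fun z hz => (hball z hz).2.2) (convex_ball x δ).isPreconnected hw hGw

variable (κ : Type*) [Fintype κ]

/-- Functions on `ℂ^κ` analytic at the origin. -/
def analyticFunctions : Subalgebra ℂ ((κ → ℂ) → ℂ) where
  carrier := {F | AnalyticAt ℂ F 0}
  mul_mem' := fun hF hG => AnalyticAt.mul hF hG
  add_mem' := fun hF hG => AnalyticAt.add hF hG
  algebraMap_mem' := fun _ => analyticAt_const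

/-- Passage to the germ, as a morphism of algebras. -/
def germHom {P : Type*} (l : Filter P) : (P → ℂ) →ₐ[ℂ] Germ l ℂ where
  toFun F := (F : Germ l ℂ)
  map_one' := rfl
  map_mul' _ _ := rfl
  map_zero' := rfl
  map_add' _ _ := rfl
  commutes' c := by
    rw [Algebra.algebraMap_eq_smul_one (A := Germ l ℂ), Algebra.algebraMap_eq_smul_one]
    rfl

/-- The ring of germs at the origin of analytic functions on `ℂ^κ`: the local model of
`AnalyticGerm x` at a smooth point `x`. -/
def OriginGerm : Subalgebra ℂ (Germ (𝓝 (0 : κ → ℂ)) ℂ) :=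
  (analyticFunctions κ).map (germHom _)

variable {κ}

/-- The coordinate functions on `ℂ^κ`. -/
def coordFun (i : κ) : analyticFunctions κ :=
  ⟨fun z => z i, (ContinuousLinearMap.proj (R := ℂ) (φ := fun _ : κ => ℂ) i).analyticAt 0⟩

namespace OriginGerm

/-- The germ of an analytic function. -/
def mk : analyticFunctions κ →ₐ[ℂ] OriginGerm κ :=
  ((germHom (𝓝 (0 : κ → ℂ))).comp (analyticFunctions κ).val).codRestrict _ fun F =>
    ⟨F, F.2, rfl⟩

theorem mk_surjective : Function.Surjective (mk (κ := κ)) := by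
  rintro ⟨_, F, hF, rfl⟩
  exact ⟨⟨F, hF⟩, rfl⟩

theorem mk_eq_mk {F G : analyticFunctions κ} :
    mk F = mk G ↔ ∀ᶠ z in 𝓝 (0 : κ → ℂ), F.1 z = G.1 z := by
  rw [Subtype.ext_iff]
  exact Germ.coe_eq

theorem mk_eq_zero {F : analyticFunctions κ} :
    mk F = 0 ↔ ∀ᶠ z in 𝓝 (0 : κ → ℂ), F.1 z = 0 := by
  rw [← map_zero mk, mk_eq_mk]
  rfl

/-- The value at the origin. -/
def value : OriginGerm κ →+* ℂ :=
  (Germ.valueRingHom (X := κ → ℂ) (E := ℂ) (x := 0)).comp (OriginGerm κ).val.toRingHom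

theorem isUnit_of_value_ne_zero {g : OriginGerm κ} (hg : value g ≠ 0) : IsUnit g := by
  obtain ⟨F, rfl⟩ := mk_surjective g
  replace hg : F.1 0 ≠ 0 := hg
  refine IsUnit.of_mul_eq_one (mk ⟨fun z => (F.1 z)⁻¹, AnalyticAt.inv F.2 hg⟩) ?_
  rw [← map_mul, ← map_one mk, mk_eq_mk]
  filter_upwards [AnalyticAt.continuousAt F.2 |>.eventually_ne hg] with z hz
  exact mul_inv_cancel₀ hz

instance : Nontrivial (OriginGerm κ) := value.domain_nontrivial

instance : NoZeroDivisors (OriginGerm κ) where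
  eq_zero_or_eq_zero_of_mul_eq_zero {g h} hgh := by
    obtain ⟨F, rfl⟩ := mk_surjective g
    obtain ⟨G, rfl⟩ := mk_surjective h
    rw [← map_mul, mk_eq_zero] at hgh
    rw [mk_eq_zero, mk_eq_zero]
    exact eventually_eq_zero_or_eventually_eq_zero F.2 G.2 hgh

instance : IsDomain (OriginGerm κ) := NoZeroDivisors.to_isDomain _

/-- The coordinate germs. -/
def coord (i : κ) : OriginGerm κ := mk (coordFun i)

theorem algebraicIndependent_coord : AlgebraicIndependent ℂ (coord (κ := κ)) := by
  rw [algebraicIndependent_iff]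
  intro q hq
  have heval : ∀ z, (MvPolynomial.aeval coordFun q).1 z = MvPolynomial.eval z q := fun z => by
    rw [← MvPolynomial.aeval_eq_eval]
    exact MvPolynomial.comp_aeval_apply coordFun
      ((Pi.evalAlgHom ℂ (fun _ : κ → ℂ => ℂ) z).comp (analyticFunctions κ).val) q
  rw [show MvPolynomial.aeval (coord (κ := κ)) q = mk (MvPolynomial.aeval coordFun q) from
    (MvPolynomial.comp_aeval_apply coordFun mk q).symm, mk_eq_zero] at hq
  simp only [heval] at hq
  refine MvPolynomial.funext fun z => ?_
  rw [map_zero]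
  exact (AnalyticOnNhd.eval_mvPolynomial q).eqOn_zero_of_preconnected_of_eventuallyEq_zero
    isPreconnected_univ (Set.mem_univ 0) hq (Set.mem_univ z)

section PartialDerivatives

variable [DecidableEq κ]

/-- Partial derivatives of analytic functions. -/
def partialFun (i : κ) (F : analyticFunctions κ) : analyticFunctions κ :=
  ⟨fun z => fderiv ℂ F.1 z (Pi.single i 1), analyticAt_clm_apply_const (AnalyticAt.fderiv F.2) _⟩

/-- Partial derivatives of germs, as bare functions. -/
def pderivFun (i : κ) (g : OriginGerm κ) : OriginGerm κ :=
  mk (partialFun i (Function.surjInv mk_surjective g))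

theorem pderivFun_mk (i : κ) (F : analyticFunctions κ) :
    pderivFun i (mk F) = mk (partialFun i F) := by
  have h : (Function.surjInv mk_surjective (mk F)).1 =ᶠ[𝓝 0] F.1 :=
    mk_eq_mk.mp (Function.surjInv_eq mk_surjective _)
  refine mk_eq_mk.mpr ?_
  filter_upwards [h.fderiv (𝕜 := ℂ)] with z hz
  exact DFunLike.congr_fun hz _

theorem pderivFun_add (i : κ) (g h : OriginGerm κ) :
    pderivFun i (g + h) = pderivFun i g + pderivFun i h := by
  obtain ⟨F, rfl⟩ := mk_surjective g
  obtain ⟨G, rfl⟩ := mk_surjective h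
  rw [← map_add, pderivFun_mk, pderivFun_mk, pderivFun_mk, ← map_add, mk_eq_mk]
  filter_upwards [AnalyticAt.eventually_analyticAt F.2, AnalyticAt.eventually_analyticAt G.2]
    with z hF hG
  exact DFunLike.congr_fun (fderiv_add hF.differentiableAt hG.differentiableAt) _

theorem pderivFun_mul (i : κ) (g h : OriginGerm κ) :
    pderivFun i (g * h) = g * pderivFun i h + h * pderivFun i g := by
  obtain ⟨F, rfl⟩ := mk_surjective g
  obtain ⟨G, rfl⟩ := mk_surjective h
  rw [← map_mul, pderivFun_mk, pderivFun_mk, pderivFun_mk, ← map_mul, ← map_mul, ← map_add,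
    mk_eq_mk]
  filter_upwards [AnalyticAt.eventually_analyticAt F.2, AnalyticAt.eventually_analyticAt G.2]
    with z hF hG
  exact DFunLike.congr_fun (fderiv_mul hF.differentiableAt hG.differentiableAt) _

theorem pderivFun_smul (i : κ) (c : ℂ) (g : OriginGerm κ) :
    pderivFun i (c • g) = c • pderivFun i g := by
  obtain ⟨F, rfl⟩ := mk_surjective g
  rw [← map_smul, pderivFun_mk, pderivFun_mk, ← map_smul, mk_eq_mk]
  filter_upwards [AnalyticAt.eventually_analyticAt F.2] with z hF
  exact DFunLike.congr_fun (fderiv_const_smul hF.differentiableAt c) _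

/-- Partial derivatives of germs. -/
def pderiv (i : κ) : Derivation ℂ (OriginGerm κ) (OriginGerm κ) :=
  Derivation.mk'
    { toFun := pderivFun i, map_add' := pderivFun_add i, map_smul' := pderivFun_smul i }
    (pderivFun_mul i)

theorem pderiv_mk (i : κ) (F : analyticFunctions κ) : pderiv i (mk F) = mk (partialFun i F) :=
  pderivFun_mk i F

theorem partialFun_coordFun (i j : κ) : partialFun i (coordFun j) = if i = j then 1 else 0 := by
  refine Subtype.ext (funext fun z => ?_)
  refine (DFunLike.congr_fun
    (ContinuousLinearMap.proj (R := ℂ) (φ := fun _ : κ => ℂ) j).fderiv (Pi.single i 1)).trans ?_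
  rw [ContinuousLinearMap.proj_apply, Pi.single_apply, if_congr eq_comm rfl rfl]
  split_ifs <;> rfl

theorem pderiv_coord (i j : κ) : pderiv i (coord j) = if i = j then 1 else 0 := by
  rw [coord, pderiv_mk, partialFun_coordFun, apply_ite mk, map_one, map_zero]

end PartialDerivatives

section VanishingOrder

theorem analyticAt_comp_smul (z : κ → ℂ) (F : analyticFunctions κ) :
    AnalyticAt ℂ (fun t : ℂ => F.1 (t • z)) 0 :=
  AnalyticAt.comp_of_eq F.2 (((ContinuousLinearMap.id ℂ ℂ).smulRight z).analyticAt 0)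
    (zero_smul ℂ z)

/-- The order of vanishing at the origin along the line spanned by `z`. -/
def rayOrder (z : κ → ℂ) (g : OriginGerm κ) : ℕ∞ :=
  analyticOrderAt (fun t : ℂ => (Function.surjInv mk_surjective g).1 (t • z)) 0

theorem rayOrder_mk (z : κ → ℂ) (F : analyticFunctions κ) :
    rayOrder z (mk F) = analyticOrderAt (fun t : ℂ => F.1 (t • z)) 0 := by
  have hline : Tendsto (fun t : ℂ => t • z) (𝓝 0) (𝓝 0) := by
    have hcont : Continuous fun t : ℂ => t • z := by fun_prop
    simpa using hcont.tendsto 0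
  exact analyticOrderAt_congr
    (hline.eventually (mk_eq_mk.mp (Function.surjInv_eq mk_surjective (mk F))))

theorem rayOrder_zero (z : κ → ℂ) : rayOrder z 0 = ⊤ := by
  rw [← map_zero mk, rayOrder_mk, analyticOrderAt_eq_top]
  exact Eventually.of_forall fun _ => rfl

theorem min_rayOrder_le_rayOrder_add (z : κ → ℂ) (g h : OriginGerm κ) :
    min (rayOrder z g) (rayOrder z h) ≤ rayOrder z (g + h) := by
  obtain ⟨F, rfl⟩ := mk_surjective g
  obtain ⟨G, rfl⟩ := mk_surjective h
  rw [← map_add, rayOrder_mk, rayOrder_mk, rayOrder_mk]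
  exact le_analyticOrderAt_add

theorem le_rayOrder_sum (z : κ → ℂ) {ι : Type*} (s : Finset ι) {g : ι → OriginGerm κ} {n : ℕ∞}
    (h : ∀ i ∈ s, n ≤ rayOrder z (g i)) : n ≤ rayOrder z (∑ i ∈ s, g i) :=
  Finset.sum_induction g (n ≤ rayOrder z ·)
    (fun _ _ h₁ h₂ => (le_min h₁ h₂).trans (min_rayOrder_le_rayOrder_add z _ _))
    (le_top.trans_eq (rayOrder_zero z).symm) h

theorem rayOrder_mul (z : κ → ℂ) (g h : OriginGerm κ) :
    rayOrder z (g * h) = rayOrder z g + rayOrder z h := by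
  obtain ⟨F, rfl⟩ := mk_surjective g
  obtain ⟨G, rfl⟩ := mk_surjective h
  rw [← map_mul, rayOrder_mk, rayOrder_mk, rayOrder_mk]
  exact analyticOrderAt_mul (analyticAt_comp_smul z F) (analyticAt_comp_smul z G)

theorem one_le_rayOrder_coord (z : κ → ℂ) (i : κ) : 1 ≤ rayOrder z (coord i) := by
  rw [Order.one_le_iff_pos, pos_iff_ne_zero, coord, rayOrder_mk, analyticOrderAt_ne_zero]
  exact ⟨analyticAt_comp_smul z _, by simp [coordFun]⟩

theorem eq_zero_of_le_rayOrder {g : OriginGerm κ} (h : ∀ z, ∀ n : ℕ, n ≤ rayOrder z g) :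
    g = 0 := by
  obtain ⟨F, rfl⟩ := mk_surjective g
  rw [mk_eq_zero]
  refine eventually_eq_zero_of_forall_line F.2 fun z => ?_
  rw [← analyticOrderAt_eq_top, ← rayOrder_mk]
  exact ENat.eq_top_iff_forall_ge.mpr (h z)

theorem exists_eq_add_sum_coord_mul (g : OriginGerm κ) :
    ∃ (c : ℂ) (h : κ → OriginGerm κ), g = algebraMap ℂ _ c + ∑ i, coord i * h i := by
  classical
  obtain ⟨F, rfl⟩ := mk_surjective g
  obtain ⟨G, hG, hFG⟩ := exists_analyticAt_hadamard (F := F.1) F.2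
  let H : κ → analyticFunctions κ := fun i =>
    ⟨fun z => G z (Pi.single i 1), analyticAt_clm_apply_const hG _⟩
  refine ⟨F.1 0, fun i => mk (H i), ?_⟩
  simp only [coord, ← map_mul, ← map_sum, ← AlgHom.commutes mk, ← map_add]
  rw [mk_eq_mk]
  filter_upwards [hFG] with z hz
  rw [hz, clm_apply_eq_sum_single]
  simp [H, coordFun]

/- By Hadamard's lemma, each application of the Leibniz rule raises by one the order of vanishing of
the functions `V g`. -/
theorem derivation_eq_zero {V : Derivation ℂ (OriginGerm κ) (OriginGerm κ)}
    (h : ∀ i, V (coord i) = 0) : V = 0 := by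
  have horder : ∀ n : ℕ, ∀ z g, (n : ℕ∞) ≤ rayOrder z (V g) := by
    intro n
    induction n with
    | zero => simp
    | succ n ih =>
      intro z g
      obtain ⟨c, k, rfl⟩ := exists_eq_add_sum_coord_mul g
      simp only [map_add, map_sum, V.map_algebraMap, zero_add, V.leibniz, h, smul_eq_mul]
      refine le_rayOrder_sum z _ fun i _ => ?_
      rw [mul_zero, add_zero, rayOrder_mul, Nat.cast_succ, add_comm]
      exact add_le_add (one_le_rayOrder_coord z i) (ih z _)
  ext1 g
  exact eq_zero_of_le_rayOrder fun z n => horder n z g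

end VanishingOrder

section FundamentalSolutions

variable [DecidableEq κ]

/-- The standard coordinates on `ℂ^κ`. -/
def coordinates : Coordinates ℂ (OriginGerm κ) κ where
  coord := coord
  pderiv := pderiv
  pderiv_coord := pderiv_coord
  derivation_eq_zero _ := derivation_eq_zero

attribute [local instance] Matrix.linftyOpNormedRing Matrix.linftyOpNormedAlgebra

/-- Matrix entries, as continuous linear forms. -/
def entryCLM (a b : κ) : Matrix κ κ ℂ →L[ℂ] ℂ :=
  LinearMap.toContinuousLinearMap (Matrix.entryLinearMap ℂ ℂ a b)

/-- The germ of an analytic function with matrix values. -/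
def matrixMk (u : (κ → ℂ) → Matrix κ κ ℂ) (hu : AnalyticAt ℂ u 0) : Matrix κ κ (OriginGerm κ) :=
  Matrix.of fun a b => mk ⟨fun z => u z a b, ((entryCLM a b).analyticAt _).comp hu⟩

theorem exists_matrixMk_eq (Γ : Matrix κ κ (OriginGerm κ)) : ∃ u hu, matrixMk u hu = Γ := by
  choose F hF using fun a b => mk_surjective (Γ a b)
  refine ⟨fun z => ∑ a, ∑ b, (F a b).1 z • Matrix.single a b 1,
    Finset.analyticAt_fun_sum _ fun a _ => Finset.analyticAt_fun_sum _ fun b _ =>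
      AnalyticAt.smul (F a b).2 analyticAt_const, ?_⟩
  refine Matrix.ext fun a b => ?_
  rw [← hF]
  refine (mk_eq_mk (κ := κ)).mpr (Eventually.of_forall fun z => ?_)
  simp [Matrix.sum_apply, Matrix.single_apply, ite_and]

theorem matrixMk_eq_matrixMk {u v : (κ → ℂ) → Matrix κ κ ℂ} {hu : AnalyticAt ℂ u 0}
    {hv : AnalyticAt ℂ v 0} : matrixMk u hu = matrixMk v hv ↔ ∀ᶠ z in 𝓝 0, u z = v z := by
  simp only [← Matrix.ext_iff, eventually_all]
  exact forall₂_congr fun a b => mk_eq_mk (κ := κ)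

theorem map_pderiv_matrixMk (i : κ) {u : (κ → ℂ) → Matrix κ κ ℂ} (hu : AnalyticAt ℂ u 0) :
    (matrixMk u hu).map (pderiv i) = matrixMk (fun z => fderiv ℂ u z (Pi.single i 1))
      (analyticAt_clm_apply_const hu.fderiv _) := by
  refine Matrix.ext fun a b => ?_
  rw [Matrix.map_apply, matrixMk, Matrix.of_apply, pderiv_mk]
  refine (mk_eq_mk (κ := κ)).mpr ?_
  filter_upwards [hu.eventually_analyticAt] with z hz
  exact DFunLike.congr_fun
    ((entryCLM a b).hasFDerivAt.comp z hz.differentiableAt.hasFDerivAt).fderiv _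

theorem matrixMk_mul {u v : (κ → ℂ) → Matrix κ κ ℂ} (hu : AnalyticAt ℂ u 0)
    (hv : AnalyticAt ℂ v 0) : matrixMk u hu * matrixMk v hv = matrixMk (u * v) (hu.mul hv) := by
  refine Matrix.ext fun a b => ?_
  simp only [Matrix.mul_apply, matrixMk, Matrix.of_apply, ← map_mul, ← map_sum]
  refine (mk_eq_mk (κ := κ)).mpr (Eventually.of_forall fun z => ?_)
  simp [Matrix.mul_apply]

theorem isUnit_det_matrixMk {u : (κ → ℂ) → Matrix κ κ ℂ} (hu : AnalyticAt ℂ u 0)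
    (h : u 0 = 1) : IsUnit (matrixMk u hu).det := by
  refine isUnit_of_value_ne_zero ?_
  have hvalue : value.mapMatrix (matrixMk u hu) = 1 := h
  rw [RingHom.map_det, hvalue, Matrix.det_one]
  exact one_ne_zero

theorem hasFundamentalSolutions : (coordinates (κ := κ)).HasFundamentalSolutions := by
  intro Γ hflat
  choose f hf hΓ using fun i => exists_matrixMk_eq (Γ i)
  have hflat' : ∀ i j, ∀ᶠ z in 𝓝 (0 : κ → ℂ), fderiv ℂ (f j) z (Pi.single i 1) -
      fderiv ℂ (f i) z (Pi.single j 1) + (f i z * f j z - f j z * f i z) = 0 := by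
    intro i j
    have han : AnalyticAt ℂ (fun z => fderiv ℂ (f j) z (Pi.single i 1) -
        fderiv ℂ (f i) z (Pi.single j 1) + (f i z * f j z - f j z * f i z)) 0 :=
      ((analyticAt_clm_apply_const (hf j).fderiv _).sub
        (analyticAt_clm_apply_const (hf i).fderiv _)).add
        (((hf i).mul (hf j)).sub ((hf j).mul (hf i)))
    have h := hflat i j
    simp only [coordinates, ← hΓ, map_pderiv_matrixMk, matrixMk_mul] at h
    exact (matrixMk_eq_matrixMk (hu := han) (hv := analyticAt_const)).mp h
  have := FiniteDimensional.complete ℂ (Matrix κ κ ℂ)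
  obtain ⟨u, hu, hu0, hpar⟩ := exists_analyticAt_parallel_of_coordinates hf hflat'
  refine ⟨matrixMk u hu, isUnit_det_matrixMk hu hu0, fun i => ?_⟩
  rw [← hΓ, matrixMk_mul]
  refine (map_pderiv_matrixMk i hu).trans ?_
  exact matrixMk_eq_matrixMk (hv := ((hf i).mul hu).neg).mpr (hpar i)

end FundamentalSolutions

end OriginGerm

end OriginGerm

section ImplicitFunction

variable {𝕜 E F G : Type*} [NontriviallyNormedField 𝕜]
  [NormedAddCommGroup E] [NormedSpace 𝕜 E] [CompleteSpace E] [NormedAddCommGroup F]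
  [NormedSpace 𝕜 F] [NormedAddCommGroup G] [NormedSpace 𝕜 G]

theorem exists_analyticAt_parametrization_zeros {f : E → F} {a : E} (hf : AnalyticAt 𝕜 f a)
    (hfa : f a = 0) (π : E →L[𝕜] G) (hinv : (π.prod (fderiv 𝕜 f a)).IsInvertible) :
    ∃ ψ : G → E, AnalyticAt 𝕜 ψ 0 ∧
      (∀ᶠ w in 𝓝 0, π (ψ w - a) = w ∧ f (ψ w) = 0) ∧
      ∀ᶠ z in 𝓝 a, f z = 0 → ψ (π (z - a)) = z := by
  obtain ⟨L, hL⟩ := hinv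
  let Φ : E → G × F := fun z => (π (z - a), f z)
  have hΦa : Φ a = 0 := by simp [Φ, hfa]
  have hπ : AnalyticAt 𝕜 (fun z => π (z - a)) a :=
    (π.analyticAt _).comp (analyticAt_id.sub analyticAt_const)
  have hΦ : AnalyticAt 𝕜 Φ a := hπ.prod hf
  have hderiv : HasFDerivAt Φ (L : E →L[𝕜] G × F) a := by
    rw [hL]
    exact (π.hasFDerivAt.comp a ((hasFDerivAt_id a).sub_const a)).prodMk
      hf.differentiableAt.hasFDerivAt
  have hstrict : HasStrictFDerivAt Φ (L : E →L[𝕜] G × F) a := by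
    simpa only [hderiv.fderiv] using hΦ.hasStrictFDerivAt
  let e := hstrict.toOpenPartialHomeomorph Φ
  have ha : a ∈ e.source := hstrict.mem_toOpenPartialHomeomorph_source
  have htarget : (0 : G × F) ∈ e.target := hΦa ▸ e.map_source ha
  have hsymm : AnalyticAt 𝕜 e.symm 0 := hΦa ▸ e.analyticAt_symm' ha hΦ hderiv.fderiv
  have hinl : AnalyticAt 𝕜 (fun w : G => (w, (0 : F))) 0 := analyticAt_id.prod analyticAt_const
  refine ⟨fun w => e.symm (w, 0), hsymm.comp_of_eq hinl rfl, ?_, ?_⟩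
  · filter_upwards [hinl.continuousAt.eventually (e.open_target.mem_nhds htarget)] with w hw
    exact Prod.ext_iff.mp (e.right_inv hw)
  · filter_upwards [e.open_source.mem_nhds ha] with z hz hfz
    have hΦz : Φ z = (π (z - a), 0) := Prod.ext rfl hfz
    rw [← hΦz]
    exact e.left_inv hz

end ImplicitFunction

section JacobianMinor

variable {𝕜 ι σ : Type*} [NontriviallyNormedField 𝕜] [Fintype ι] [DecidableEq ι] [Fintype σ]
  [DecidableEq σ]

/-- The projection of `𝕜^ι` to the coordinates outside the range of `m`. -/
def freeCoordinates (𝕜 : Type*) [NontriviallyNormedField 𝕜] {ι σ : Type*} (m : σ → ι) :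
    (ι → 𝕜) →L[𝕜] ((Set.range m)ᶜ : Set ι) → 𝕜 :=
  ContinuousLinearMap.pi fun k => ContinuousLinearMap.proj k.1

theorem prod_freeCoordinates_injective {m : σ → ι} (hm : Function.Injective m)
    {L : (ι → 𝕜) →L[𝕜] σ → 𝕜}
    (hL : IsUnit (Matrix.of fun s r => L (Pi.single (m s) 1) r).det) :
    Function.Injective ((freeCoordinates 𝕜 m).prod L) := by
  refine (injective_iff_map_eq_zero _).mpr fun v hv => ?_
  have hfree : ∀ i ∉ Set.range m, v i = 0 := fun i hi =>
    congrFun (congrArg Prod.fst hv) ⟨i, hi⟩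
  have hminor : Matrix.vecMul (fun s => v (m s)) (Matrix.of fun s r => L (Pi.single (m s) 1) r) =
      0 := by
    have hsum : L v = ∑ s, v (m s) • L (Pi.single (m s) 1) := by
      conv_lhs => rw [← Finset.univ_sum_single v, map_sum]
      refine (Finset.sum_of_injOn m hm.injOn (by simp) (fun i _ hi => ?_) fun s _ => ?_).symm
      · rw [hfree i (by simpa using hi), Pi.single_zero, map_zero]
      · rw [← map_smul, ← Pi.single_smul, smul_eq_mul, mul_one]
    have hLv : L v = 0 := congrArg Prod.snd hv
    rw [← hLv, hsum]
    ext r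
    simp [Matrix.vecMul, dotProduct, Finset.sum_apply]
  have hpivot : (fun s => v (m s)) = 0 :=
    Matrix.vecMul_injective_of_isUnit ((Matrix.isUnit_iff_isUnit_det _).mpr hL)
      (hminor.trans (Matrix.zero_vecMul _).symm)
  ext i
  by_cases hi : i ∈ Set.range m
  · obtain ⟨s, rfl⟩ := hi
    exact congrFun hpivot s
  · exact hfree i hi

theorem isInvertible_prod_freeCoordinates [CompleteSpace 𝕜] {m : σ → ι} (hm : Function.Injective m)
    {L : (ι → 𝕜) →L[𝕜] σ → 𝕜}
    (hL : IsUnit (Matrix.of fun s r => L (Pi.single (m s) 1) r).det) :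
    ((freeCoordinates 𝕜 m).prod L).IsInvertible := by
  have hdim : Module.finrank 𝕜 (ι → 𝕜) =
      Module.finrank 𝕜 ((((Set.range m)ᶜ : Set ι) → 𝕜) × (σ → 𝕜)) := by
    have := Fintype.card_le_of_injective m hm
    simp only [Module.finrank_prod, Module.finrank_fintype_fun_eq_card, Fintype.card_compl_set,
      Set.card_range_of_injective hm]
    omega
  exact ⟨(LinearEquiv.ofInjectiveOfFinrankEq _ (prod_freeCoordinates_injective hm hL)
    hdim).toContinuousLinearEquiv, rfl⟩

end JacobianMinor

section Presentation

theorem hasFDerivAt_eval {𝕜 ι : Type*} [NontriviallyNormedField 𝕜] [Fintype ι]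
    (q : MvPolynomial ι 𝕜) (z : ι → 𝕜) :
    HasFDerivAt (fun z => MvPolynomial.eval z q)
      (∑ i, MvPolynomial.eval z (MvPolynomial.pderiv i q) •
        ContinuousLinearMap.proj (R := 𝕜) (φ := fun _ : ι => 𝕜) i) z := by
  classical
  induction q using MvPolynomial.induction_on with
  | C a =>
    simp only [MvPolynomial.eval_C]
    refine (hasFDerivAt_const a z).congr_fderiv ?_
    ext v
    simp
  | add p q hp hq =>
    simp only [map_add]
    refine (hp.add hq).congr_fderiv ?_
    ext v
    simp [add_mul, Finset.sum_add_distrib]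
  | mul_X p j hp =>
    simp only [map_mul, MvPolynomial.eval_X]
    refine (hp.mul (hasFDerivAt_apply j z)).congr_fderiv ?_
    ext v
    simp [MvPolynomial.pderiv_X, Pi.single_apply, Finset.sum_add_distrib, add_mul,
      Finset.mul_sum, apply_ite (MvPolynomial.eval z), mul_assoc]

variable {R S ι σ : Type*} [CommRing R] [CommRing S] [Algebra R S]

theorem eval_val (P : Algebra.Generators R S ι) (φ : S →ₐ[R] R) (q : MvPolynomial ι R) :
    MvPolynomial.eval (fun i => φ (P.val i)) q = φ (MvPolynomial.aeval P.val q) := by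
  rw [← AlgHom.comp_apply, MvPolynomial.comp_aeval, MvPolynomial.aeval_eq_eval]

theorem exists_algHom_val_eq (P : Algebra.Presentation R S ι σ) {z : ι → R}
    (hz : ∀ r, MvPolynomial.eval z (P.relation r) = 0) :
    ∃ φ : S →ₐ[R] R, ∀ i, φ (P.val i) = z i := by
  have hker : P.ker ≤ RingHom.ker (MvPolynomial.aeval (R := R) z) := by
    rw [← P.span_range_relation_eq_ker, Ideal.span_le]
    rintro _ ⟨r, rfl⟩
    exact hz r
  rw [P.ker_eq_ker_aeval_val] at hker
  refine ⟨AlgHom.liftOfSurjective _ P.aeval_val_surjective _ hker, fun i => ?_⟩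
  have hX := AlgHom.liftOfSurjective_apply _ P.aeval_val_surjective _ hker (MvPolynomial.X i)
  simpa only [MvPolynomial.aeval_X] using hX

variable [Algebra ℂ S] [Fintype ι] [DecidableEq ι] [Fintype σ]

theorem exists_analyticAt_parametrization_relations (P : Algebra.SubmersivePresentation ℂ S ι σ)
    (φ : S →ₐ[ℂ] ℂ) :
    ∃ ψ : (((Set.range P.map)ᶜ : Set ι) → ℂ) → (ι → ℂ), AnalyticAt ℂ ψ 0 ∧
      (∀ᶠ w in 𝓝 0, (∀ k : ((Set.range P.map)ᶜ : Set ι), ψ w k - φ (P.val k) = w k) ∧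
        ∀ r, MvPolynomial.eval (ψ w) (P.relation r) = 0) ∧
      ∀ᶠ z in 𝓝 (fun i => φ (P.val i)), (∀ r, MvPolynomial.eval z (P.relation r) = 0) →
        ψ (fun k => z k - φ (P.val k)) = z := by
  classical
  let a : ι → ℂ := fun i => φ (P.val i)
  let f : (ι → ℂ) → σ → ℂ := fun z r => MvPolynomial.eval z (P.relation r)
  have hf : AnalyticAt ℂ f a := AnalyticAt.pi fun r =>
    AnalyticOnNhd.eval_mvPolynomial (P.relation r) a (Set.mem_univ _)
  have hfa : f a = 0 := funext fun r => by
    simp only [f, a, eval_val P.toGenerators, P.aeval_val_relation, map_zero, Pi.zero_apply]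
  have hderiv := hasFDerivAt_pi.mpr fun r => hasFDerivAt_eval (P.relation r) a
  have hminor : (Matrix.of fun s r => fderiv ℂ f a (Pi.single (P.map s) 1) r) =
      P.jacobiMatrix.map (MvPolynomial.eval a) := by
    ext s r
    simp [f, hderiv.fderiv, P.jacobiMatrix_apply, Pi.single_apply]
  have hjacobian : (P.jacobiMatrix.map (MvPolynomial.eval a)).det = φ P.jacobian := by
    rw [P.jacobian_eq_jacobiMatrix_det, P.algebraMap_eq]
    exact (RingHom.map_det _ _).symm.trans (eval_val P.toGenerators φ _)
  obtain ⟨ψ, hψ, hψ_right, hψ_left⟩ := exists_analyticAt_parametrization_zeros hf hfa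
    (freeCoordinates ℂ P.map) <| isInvertible_prod_freeCoordinates P.map_inj <| by
      rw [hminor, hjacobian]
      exact P.jacobian_isUnit.map φ
  exact ⟨ψ, hψ, hψ_right.mono fun w hw => ⟨congrFun hw.1, congrFun hw.2⟩,
    hψ_left.mono fun z hz hr => hz (funext hr)⟩

end Presentation

section GermPullback

variable {P Q : Type*} {l : Filter P} {m : Filter Q} {T : P → Q} {s : Q → P}

/-- Pullback of germs along a map. -/
def germPullback (hT : Tendsto T l m) : Germ m ℂ →ₐ[ℂ] Germ l ℂ where
  toFun g := g.compTendsto T hT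
  map_one' := rfl
  map_mul' g h := by
    induction g using Germ.inductionOn
    induction h using Germ.inductionOn
    rfl
  map_zero' := rfl
  map_add' g h := by
    induction g using Germ.inductionOn
    induction h using Germ.inductionOn
    rfl
  commutes' c := by
    rw [Algebra.algebraMap_eq_smul_one (A := Germ l ℂ), Algebra.algebraMap_eq_smul_one]
    rfl

theorem germPullback_germPullback (hT : Tendsto T l m) (hs : Tendsto s m l)
    (hTs : ∀ᶠ w in m, T (s w) = w) (g : Germ m ℂ) : germPullback hs (germPullback hT g) = g := by
  induction g using Germ.inductionOn with | _ F =>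
  exact Germ.coe_eq.mpr (hTs.mono fun w hw => congrArg F hw)

/-- The isomorphism of algebras of germs induced by maps inverse to each other near the base
points. -/
def germEquiv (hT : Tendsto T l m) (hs : Tendsto s m l) (hTs : ∀ᶠ w in m, T (s w) = w)
    (hsT : ∀ᶠ y in l, s (T y) = y) {B : Subalgebra ℂ (Germ m ℂ)} {C : Subalgebra ℂ (Germ l ℂ)}
    (hBC : ∀ g ∈ B, germPullback hT g ∈ C) (hCB : ∀ g ∈ C, germPullback hs g ∈ B) : B ≃ₐ[ℂ] C :=
  AlgEquiv.ofAlgHom (((germPullback hT).comp B.val).codRestrict C fun g => hBC g g.2)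
    (((germPullback hs).comp C.val).codRestrict B fun g => hCB g g.2)
    (AlgHom.ext fun g => Subtype.ext (germPullback_germPullback hs hT hsT g.1))
    (AlgHom.ext fun g => Subtype.ext (germPullback_germPullback hT hs hTs g.1))

end GermPullback

section Points

variable {A : Type*} [CommRing A] [Algebra ℂ A] {x : Point A}

theorem Point.ext {y y' : Point A} (h : ∀ a, y.eval a = y'.eval a) : y = y' := by
  cases y
  cases y'
  exact congrArg Point.mk (AlgHom.ext h)

theorem continuous_eval (a : A) : Continuous fun y : Point A => y.eval a :=
  (continuous_apply a).comp continuous_induced_dom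

theorem tendsto_nhds_point {α : Type*} {l : Filter α} {g : α → Point A}
    (h : ∀ a, Tendsto (fun w => (g w).eval a) l (𝓝 (x.eval a))) : Tendsto g l (𝓝 x) := by
  rw [nhds_induced, tendsto_comap_iff, tendsto_pi_nhds]
  exact h

theorem comp_mem_analyticGerm {α : Type*} [Fintype α] {u : α → Point A → ℂ}
    (hu : ∀ i, (u i : Germ (𝓝 x) ℂ) ∈ AnalyticGerm x) {F : (α → ℂ) → ℂ}
    (hF : AnalyticAt ℂ F fun i => u i x) :
    ((fun y => F fun i => u i y : Point A → ℂ) : Germ (𝓝 x) ℂ) ∈ AnalyticGerm x := by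
  choose n a G hG hGu using hu
  replace hGu := fun i => Germ.coe_eq.mp (hGu i)
  let e := Fintype.equivFin (Σ i, Fin (n i))
  let proj (i : α) (z : Fin (Fintype.card (Σ i, Fin (n i))) → ℂ) (j : Fin (n i)) : ℂ :=
    z (e ⟨i, j⟩)
  let b : Fin (Fintype.card (Σ i, Fin (n i))) → A := fun k => a (e.symm k).1 (e.symm k).2
  have hproj (i : α) (y : Point A) : proj i (fun k => y.eval (b k)) = fun j => y.eval (a i j) :=
    funext fun j => by
      change y.eval (a (e.symm (e ⟨i, j⟩)).1 (e.symm (e ⟨i, j⟩)).2) = _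
      rw [e.symm_apply_apply]
  refine ⟨_, b, fun z => F fun i => G i (proj i z), ?_, Germ.coe_eq.mpr ?_⟩
  · refine AnalyticAt.comp_of_eq hF (AnalyticAt.pi fun i =>
      (hG i).comp_of_eq (AnalyticAt.pi fun j => ?_) (hproj i x)) (funext fun i => ?_)
    · exact (ContinuousLinearMap.proj (R := ℂ)
        (φ := fun _ : Fin (Fintype.card (Σ i, Fin (n i))) => ℂ) (e ⟨i, j⟩)).analyticAt _
    · rw [hproj]
      exact (hGu i).self_of_nhds.symm
  · filter_upwards [eventually_all.mpr hGu] with y hy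
    simp only [hproj, hy]

theorem isUnit_regularGerm {f : A} (hf : x.eval f ≠ 0) : IsUnit (regularGerm x f) := by
  have hinv : AnalyticAt ℂ (fun z : Unit → ℂ => (z ())⁻¹) fun _ => x.eval f :=
    ((ContinuousLinearMap.proj (R := ℂ) (φ := fun _ : Unit => ℂ) ()).analyticAt _).inv hf
  refine IsUnit.of_mul_eq_one
    ⟨_, comp_mem_analyticGerm (α := Unit) (fun _ => (regularGerm x f).2) hinv⟩ ?_
  refine Subtype.ext (Germ.coe_eq.mpr ?_)
  filter_upwards [(continuous_eval f).continuousAt.eventually_ne hf] with y hy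
  exact mul_inv_cancel₀ hy

end Points

section Localization

variable {A S : Type*} [CommRing A] [Algebra ℂ A] [CommRing S] [Algebra ℂ S] [Algebra A S]
  [IsScalarTower ℂ A S]

variable (A) in
/-- The image in `Spec A` of a point of `Spec S`. -/
def Point.restrict (y : Point S) : Point A :=
  ⟨y.eval.comp (IsScalarTower.toAlgHom ℂ A S)⟩

theorem Point.restrict_eval (y : Point S) (a : A) :
    (y.restrict A).eval a = y.eval (algebraMap A S a) := rfl

theorem Point.continuous_restrict : Continuous (Point.restrict A (S := S)) :=
  continuous_iff_continuousAt.mpr fun _ =>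
    tendsto_nhds_point fun a => (continuous_eval (algebraMap A S a)).continuousAt

variable (f : A) [IsLocalization.Away f S]

theorem Point.isUnit_eval_of_mem_powers {y : Point A} (hy : y.eval f ≠ 0) (m : Submonoid.powers f) :
    IsUnit (y.eval m) := by
  obtain ⟨n, hn⟩ := m.2
  rw [← hn, map_pow]
  exact (pow_ne_zero n hy).isUnit

variable (S) in
theorem exists_algHom_algebraMap_eq {y : Point A} (hy : y.eval f ≠ 0) :
    ∃ φ : S →ₐ[ℂ] ℂ, ∀ a, φ (algebraMap A S a) = y.eval a :=
  have hunit := Point.isUnit_eval_of_mem_powers f hy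
  ⟨IsLocalization.liftAlgHom (M := Submonoid.powers f) (f := y.eval) hunit,
    fun a => IsLocalization.lift_eq (M := Submonoid.powers f) hunit a⟩

variable (S) in
theorem Point.exists_restrict_eq {y : Point A} (hy : y.eval f ≠ 0) :
    ∃ y' : Point S, y'.restrict A = y := by
  obtain ⟨φ, hφ⟩ := exists_algHom_algebraMap_eq S f hy
  exact ⟨⟨φ⟩, Point.ext hφ⟩

include f in
theorem Point.restrict_injective : Function.Injective (Point.restrict A (S := S)) := by
  rintro ⟨φ⟩ ⟨ψ⟩ h
  refine congrArg Point.mk (AlgHom.coe_ringHom_injective ?_)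
  refine IsLocalization.ringHom_ext (Submonoid.powers f) (RingHom.ext fun a => ?_)
  exact congrArg (fun y : Point A => y.eval a) h

theorem Point.restrict_eval_ne_zero (y : Point S) : (y.restrict A).eval f ≠ 0 :=
  ((IsLocalization.Away.algebraMap_isUnit f).map y.eval).ne_zero

variable {f}

theorem Point.exists_eval_eq_div (b : S) : ∃ (a : A) (n : ℕ),
    ∀ y : Point S, y.eval b = (y.restrict A).eval a / (y.restrict A).eval f ^ n := by
  obtain ⟨n, a, h⟩ := IsLocalization.Away.surj f b
  refine ⟨a, n, fun y => ?_⟩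
  rw [eq_div_iff (pow_ne_zero n (y.restrict_eval_ne_zero f)), Point.restrict_eval,
    Point.restrict_eval, ← h, map_mul, map_pow]

variable (f) in
include f in
theorem Point.exists_local_extension (x : Point S) : ∃ s : Point A → Point S,
    Tendsto s (𝓝 (x.restrict A)) (𝓝 x) ∧ (∀ᶠ y in 𝓝 (x.restrict A), (s y).restrict A = y) ∧
      ∀ y', s (y'.restrict A) = y' := by
  have hinj := Point.restrict_injective f (S := S)
  have : Nonempty (Point S) := ⟨x⟩
  let s := Function.invFun (Point.restrict A (S := S))
  have hs : ∀ᶠ y in 𝓝 (x.restrict A), (s y).restrict A = y := by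
    filter_upwards [(continuous_eval f).continuousAt.eventually_ne (x.restrict_eval_ne_zero f)]
      with y hy
    exact Function.invFun_eq (Point.exists_restrict_eq S f hy)
  refine ⟨s, tendsto_nhds_point fun b => ?_, hs, Function.leftInverse_invFun hinj⟩
  obtain ⟨a, n, h⟩ := Point.exists_eval_eq_div (f := f) b
  rw [h]
  have hquot : Tendsto (fun y : Point A => y.eval a / y.eval f ^ n) (𝓝 (x.restrict A))
      (𝓝 ((x.restrict A).eval a / (x.restrict A).eval f ^ n)) :=
    (continuous_eval a).continuousAt.div ((continuous_eval f).continuousAt.pow n)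
      (pow_ne_zero n (x.restrict_eval_ne_zero f))
  exact hquot.congr' (hs.mono fun y hy => by simp only [h, hy])

variable (f) in
include f in
theorem exists_analyticGerm_restrict_algEquiv (x : Point S) :
    ∃ e : AnalyticGerm (x.restrict A) ≃ₐ[ℂ] AnalyticGerm x,
      ∀ a, e (regularGerm (x.restrict A) a) = regularGerm x (algebraMap A S a) := by
  obtain ⟨s, hs, hrs, hsr⟩ := x.exists_local_extension f
  have hr : Tendsto (Point.restrict A) (𝓝 x) (𝓝 (x.restrict A)) :=
    Point.continuous_restrict.tendsto x
  refine ⟨germEquiv hr hs hrs (Eventually.of_forall hsr) ?_ ?_, fun a => rfl⟩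
  · rintro _ ⟨n, a, F, hF, rfl⟩
    exact ⟨n, fun i => algebraMap A S (a i), F, hF, rfl⟩
  · rintro _ ⟨n, b, F, hF, rfl⟩
    refine comp_mem_analyticGerm (u := fun i y => (s y).eval (b i)) (fun i => ?_) ?_
    · obtain ⟨a, n, h⟩ := Point.exists_eval_eq_div (f := f) (b i)
      obtain ⟨g, hg⟩ :=
        ((isUnit_regularGerm (x.restrict_eval_ne_zero f)).pow n).exists_right_inv
      have hmul : ((fun y => (s y).eval (b i) : Point A → ℂ) : Germ (𝓝 (x.restrict A)) ℂ) *
          (regularGerm (x.restrict A) f ^ n : AnalyticGerm (x.restrict A)) =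
            regularGerm (x.restrict A) a := by
        refine Germ.coe_eq.mpr (hrs.mono fun y hy => ?_)
        have hf := (s y).restrict_eval_ne_zero f
        rw [hy] at hf
        change (s y).eval (b i) * y.eval f ^ n = y.eval a
        rw [h, hy, div_mul_cancel₀ _ (pow_ne_zero n hf)]
      have hdiv : ((fun y => (s y).eval (b i) : Point A → ℂ) : Germ (𝓝 (x.restrict A)) ℂ) =
          (regularGerm (x.restrict A) a * g : AnalyticGerm (x.restrict A)) := by
        rw [MulMemClass.coe_mul, ← hmul, mul_assoc, ← MulMemClass.coe_mul, hg, OneMemClass.coe_one,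
          mul_one]
      exact hdiv ▸ (regularGerm (x.restrict A) a * g).2
    · rwa [hsr]

end Localization

section Parametrization

theorem exists_algEquiv_of_parametrization {S κ : Type*} [CommRing S] [Algebra ℂ S] [Fintype κ]
    {t : κ → S} {x : Point S} (ht : ∀ k, x.eval (t k) = 0) {s : (κ → ℂ) → Point S}
    (hs : ∀ a, AnalyticAt ℂ (fun w => (s w).eval a) 0)
    (hTs : ∀ᶠ w in 𝓝 0, (fun k => (s w).eval (t k)) = w)
    (hsT : ∀ᶠ y in 𝓝 x, s (fun k => y.eval (t k)) = y) :
    ∃ e : OriginGerm κ ≃ₐ[ℂ] AnalyticGerm x, ∀ k, e (OriginGerm.coord k) = regularGerm x (t k) := by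
  let T (y : Point S) (k : κ) : ℂ := y.eval (t k)
  have hTx : T x = 0 := funext ht
  have hsx : s 0 = x := hTx ▸ hsT.self_of_nhds
  have hT : Tendsto T (𝓝 x) (𝓝 0) :=
    hTx ▸ (continuous_pi fun k => continuous_eval (t k)).tendsto x
  have hs' : Tendsto s (𝓝 0) (𝓝 x) := tendsto_nhds_point fun a => by
    simpa only [hsx] using (hs a).continuousAt.tendsto
  refine ⟨germEquiv hT hs' hTs hsT ?_ ?_, fun k => rfl⟩
  · rintro _ ⟨F, hF, rfl⟩
    have hF' : AnalyticAt ℂ F (T x) := hTx ▸ hF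
    exact comp_mem_analyticGerm (fun k => (regularGerm x (t k)).2) hF'
  · rintro _ ⟨n, a, F, hF, rfl⟩
    exact ⟨_, hF.comp_of_eq (AnalyticAt.pi fun i => hs (a i)) (by simp only [hsx]), rfl⟩

variable {S ι σ : Type*} [CommRing S] [Algebra ℂ S] [Fintype ι] [DecidableEq ι] [Fintype σ]

theorem exists_parametrization (P : Algebra.SubmersivePresentation ℂ S ι σ) (x : Point S) :
    ∃ s : (((Set.range P.map)ᶜ : Set ι) → ℂ) → Point S,
      (∀ a, AnalyticAt ℂ (fun w => (s w).eval a) 0) ∧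
      (∀ᶠ w in 𝓝 0, ∀ k : ((Set.range P.map)ᶜ : Set ι),
        (s w).eval (P.val k) - x.eval (P.val k) = w k) ∧
      ∀ᶠ y in 𝓝 x, s (fun k => y.eval (P.val k) - x.eval (P.val k)) = y := by
  obtain ⟨ψ, hψ, hψ_right, hψ_left⟩ := exists_analyticAt_parametrization_relations P x.eval
  have hex : ∀ᶠ w in 𝓝 0, ∃ y : Point S, ∀ i, y.eval (P.val i) = ψ w i :=
    hψ_right.mono fun w hw => by
      obtain ⟨φ, hφ⟩ := exists_algHom_val_eq P.toPresentation hw.2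
      exact ⟨⟨φ⟩, hφ⟩
  have : Nonempty (Point S) := ⟨x⟩
  obtain ⟨s, hs⟩ := hex.choice
  have hval (y : Point S) (q : MvPolynomial ι ℂ) :
      MvPolynomial.eval (fun i => y.eval (P.val i)) q = y.eval (MvPolynomial.aeval P.val q) :=
    eval_val P.toGenerators y.eval q
  refine ⟨s, fun a => ?_, ?_, ?_⟩
  · obtain ⟨q, rfl⟩ := P.aeval_val_surjective a
    have hq : AnalyticAt ℂ (fun w => MvPolynomial.eval (ψ w) q) 0 :=
      (AnalyticOnNhd.eval_mvPolynomial q (ψ 0) (Set.mem_univ _)).comp hψ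
    exact hq.congr (hs.mono fun w hw => by simp only [← hval, hw])
  · filter_upwards [hψ_right, hs] with w hw hsw k
    rw [hsw, hw.1]
  · have hT : Tendsto (fun (y : Point S) i => y.eval (P.val i)) (𝓝 x)
        (𝓝 fun i => x.eval (P.val i)) :=
      tendsto_pi_nhds.mpr fun i => (continuous_eval (P.val i)).tendsto x
    have hT0 : Tendsto (fun (y : Point S) (k : ((Set.range P.map)ᶜ : Set ι)) =>
        y.eval (P.val k) - x.eval (P.val k)) (𝓝 x) (𝓝 0) :=
      tendsto_pi_nhds.mpr fun k =>
        tendsto_sub_nhds_zero_iff.mpr ((continuous_eval (P.val k)).tendsto x)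
    filter_upwards [hT.eventually hψ_left, hT0.eventually hs] with y hy hsy
    have hy := hy fun r => by rw [hval, P.aeval_val_relation, map_zero]
    refine Point.ext fun a => ?_
    obtain ⟨q, rfl⟩ := P.aeval_val_surjective a
    rw [← hval, ← hval, funext hsy, hy]

theorem exists_originGerm_algEquiv (P : Algebra.SubmersivePresentation ℂ S ι σ) (x : Point S) :
    ∃ e : OriginGerm ((Set.range P.map)ᶜ : Set ι) ≃ₐ[ℂ] AnalyticGerm x, ∀ k,
      e (OriginGerm.coord k) =
        regularGerm x (P.val k - algebraMap ℂ S (x.eval (P.val k))) := by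
  have heval (y : Point S) (k : ι) :
      y.eval (P.val k - algebraMap ℂ S (x.eval (P.val k))) =
        y.eval (P.val k) - x.eval (P.val k) := by
    rw [map_sub, AlgHom.commutes, Algebra.algebraMap_self_apply]
  obtain ⟨s, hs, hTs, hsT⟩ := exists_parametrization P x
  refine exists_algEquiv_of_parametrization (fun k => (heval x k).trans (sub_self _)) hs ?_ ?_
  · simpa only [heval, funext_iff] using hTs
  · simpa only [heval] using hsT

end Parametrization

section Differentials

open KaehlerDifferential

variable {k S κ : Type*} [CommRing k] [CommRing S] [Algebra k S] {t : κ → S}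
  (b : Module.Basis κ S Ω[S⁄k]) (hb : ∀ i, b i = D k S (t i))

include hb in
theorem derivation_eq_zero_of_basis {N : Type*} [AddCommGroup N] [Module S N] [Module k N]
    [IsScalarTower k S N] {d : Derivation k S N} (hd : ∀ i, d (t i) = 0) : d = 0 := by
  have h : d.liftKaehlerDifferential = 0 := b.ext fun i => by
    rw [hb, Derivation.liftKaehlerDifferential_comp_D, hd, LinearMap.zero_apply]
  ext s
  rw [← d.liftKaehlerDifferential_comp_D, h]
  rfl

/-- Functions whose differentials form a basis of the module of differentials are coordinates; the
vector fields `pderiv` are the dual basis. -/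
def Coordinates.ofBasis [DecidableEq κ] : Coordinates k S κ where
  coord := t
  pderiv i := (b.coord i).compDer (D k S)
  pderiv_coord i j := by
    change b.repr (D k S (t j)) i = _
    rw [← hb, b.repr_self, Finsupp.single_apply, if_congr eq_comm rfl rfl]
  derivation_eq_zero _ := derivation_eq_zero_of_basis b hb

theorem derivation_algHom_apply [DecidableEq κ] {R : Type*} [CommRing R] [Algebra k R]
    (φ : S →ₐ[k] R) {i : κ} {d : Derivation k R R}
    (hd : ∀ j, d (φ (t j)) = if i = j then 1 else 0) (s : S) :
    d (φ s) = φ ((Coordinates.ofBasis b hb).pderiv i s) := by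
  let : Algebra S R := φ.toAlgebra
  have : IsScalarTower k S R := IsScalarTower.of_algebraMap_eq fun c => (φ.commutes c).symm
  let C := Coordinates.ofBasis b hb
  have h : d.compAlgebraMap S - (Algebra.linearMap S R).compDer (C.pderiv i) = 0 :=
    derivation_eq_zero_of_basis b hb fun j => by
      have hC : φ (C.pderiv i (t j)) = if i = j then 1 else 0 := by
        rw [show t j = C.coord j from rfl, C.pderiv_coord, apply_ite φ, map_one, map_zero]
      exact sub_eq_zero.mpr ((hd j).trans hC.symm)
  exact sub_eq_zero.mp (DFunLike.congr_fun h s)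

section FractionField

variable (K : Type*) [Field K] [Algebra S K] [IsFractionRing S K] [Algebra k K]
  [IsScalarTower k S K]

/-- The basis of differentials of the fraction field. -/
def fractionBasis : Module.Basis κ K Ω[K⁄k] :=
  b.ofIsLocalizedModule K (nonZeroDivisors S) (KaehlerDifferential.map k k S K)

include hb in
theorem fractionBasis_apply (i : κ) : fractionBasis b K i = D k K (algebraMap S K (t i)) := by
  rw [fractionBasis, Module.Basis.ofIsLocalizedModule_apply, hb, KaehlerDifferential.map_D]

end FractionField

theorem formallyUnramified_of_basis {L : Type*} [CommRing L] [Algebra k L] [Algebra L S]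
    [IsScalarTower k L S] {u : κ → L} (hu : ∀ i, b i = D k S (algebraMap L S (u i))) :
    Algebra.FormallyUnramified L S := by
  have hmap : KaehlerDifferential.map k L S S = 0 := b.ext fun i => by
    rw [hu, KaehlerDifferential.map_D, Algebra.algebraMap_self_apply, Derivation.map_algebraMap,
      LinearMap.zero_apply]
  refine ⟨subsingleton_of_forall_eq 0 fun ω => ?_⟩
  obtain ⟨η, rfl⟩ := KaehlerDifferential.map_surjective k L S ω
  rw [hmap, LinearMap.zero_apply]

end Differentials

section AlgebraicIndependence

open KaehlerDifferential

variable {k S κ : Type*} [Field k] [CommRing S] [IsDomain S] [Algebra k S]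
  [Algebra.EssFiniteType k S] {t : κ → S} (b : Module.Basis κ S Ω[S⁄k])
  (hb : ∀ i, b i = D k S (t i))

include hb in
theorem exists_ne_zero_dvd_aeval (ht : AlgebraicIndependent k t) {s : S} (hs : s ≠ 0) :
    ∃ q : MvPolynomial κ k, q ≠ 0 ∧ s ∣ MvPolynomial.aeval t q := by
  let K := FractionRing S
  let L := FractionRing (MvPolynomial κ k)
  let : Algebra (MvPolynomial κ k) S := (MvPolynomial.aeval t).toAlgebra
  have : IsScalarTower k (MvPolynomial κ k) S :=
    IsScalarTower.of_algebraMap_eq fun c => ((MvPolynomial.aeval t).commutes c).symm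
  have hinj : Function.Injective (algebraMap (MvPolynomial κ k) K) := by
    rw [IsScalarTower.algebraMap_eq (MvPolynomial κ k) S K]
    exact (IsFractionRing.injective S K).comp ht
  have : FaithfulSMul (MvPolynomial κ k) K := (faithfulSMul_iff_algebraMap_injective _ _).mpr hinj
  let : Algebra L K := FractionRing.liftAlgebra (MvPolynomial κ k) K
  have : IsScalarTower (MvPolynomial κ k) L K := FractionRing.isScalarTower_liftAlgebra _ _
  have : IsScalarTower k L K := IsScalarTower.to₁₃₄ k (MvPolynomial κ k) L K
  have : Algebra.EssFiniteType S K := .of_isLocalization K (nonZeroDivisors S)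
  have : Algebra.EssFiniteType k K := .comp k S K
  have : Algebra.EssFiniteType L K := .of_comp k L K
  have hX (i : κ) :
      algebraMap L K (algebraMap (MvPolynomial κ k) L (MvPolynomial.X i)) =
        algebraMap S K (t i) := by
    rw [← IsScalarTower.algebraMap_apply, IsScalarTower.algebraMap_apply (MvPolynomial κ k) S K]
    exact congrArg (algebraMap S K) (MvPolynomial.aeval_X t i)
  have : Algebra.FormallyUnramified L K :=
    formallyUnramified_of_basis (fractionBasis b K) fun i => by rw [hX, fractionBasis_apply b hb]
  have := Algebra.FormallyUnramified.isSeparable L K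
  have halg : IsAlgebraic (MvPolynomial κ k) s := by
    rw [← isAlgebraic_algebraMap_iff (IsFractionRing.injective S K)]
    exact (IsFractionRing.isAlgebraic_iff (MvPolynomial κ k) L K).mpr
      (Algebra.IsAlgebraic.isAlgebraic _)
  exact halg.exists_nonzero_dvd (mem_nonZeroDivisors_of_ne_zero hs)

include b hb in
theorem injective_of_algebraicIndependent {R : Type*} [CommRing R] [Algebra k R] (φ : S →ₐ[k] R)
    (hφ : AlgebraicIndependent k fun i => φ (t i)) : Function.Injective φ := by
  refine (injective_iff_map_eq_zero φ).mpr fun s hs => ?_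
  by_contra hne
  obtain ⟨q, hq, r, hr⟩ := exists_ne_zero_dvd_aeval b hb (AlgebraicIndependent.of_comp φ hφ) hne
  refine hq (algebraicIndependent_iff.mp hφ q ?_)
  rw [← MvPolynomial.comp_aeval_apply, hr, map_mul, hs, zero_mul]

end AlgebraicIndependence

section Charts

open KaehlerDifferential

variable {A K : Type*} [CommRing A] [Algebra ℂ A] [Field K] [Algebra A K]

/-- Rational coordinates `C` on a variety which are regular at the point `x` and, up to additive
constants, correspond to the coordinates of `ℂ^κ` under an isomorphism of the analytic germs at `x`
with those at the origin. -/
structure Chart [Algebra ℂ K] {κ : Type*} [Fintype κ] [DecidableEq κ] (C : Coordinates ℂ K κ)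
    (x : Point A) where
  equiv : OriginGerm κ ≃ₐ[ℂ] AnalyticGerm x
  center : κ → ℂ
  isFunctionGerm : ∀ i,
    IsFunctionGerm x (C.coord i - algebraMap ℂ K (center i)) (equiv (OriginGerm.coord i))
  isFieldGerm : ∀ i, IsFieldGerm x (C.pderiv i) (conjDerivation equiv (OriginGerm.pderiv i))
  regularGerm_injective : Function.Injective (regularGermHom x)

section Localization

variable {S : Type*} [CommRing S] [Algebra ℂ S] [Algebra A S] {x : Point A} {f : A}

theorem exists_originGerm_algEquiv_of_away [IsScalarTower ℂ A S] [IsLocalization.Away f S]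
    {ι σ : Type*} [Fintype ι] [DecidableEq ι] [Fintype σ]
    (P : Algebra.SubmersivePresentation ℂ S ι σ) (hx : x.eval f ≠ 0) :
    ∃ (e : OriginGerm ((Set.range P.map)ᶜ : Set ι) ≃ₐ[ℂ] AnalyticGerm x)
      (lam : S →ₐ[ℂ] AnalyticGerm x) (c : ((Set.range P.map)ᶜ : Set ι) → ℂ),
      (∀ a, lam (algebraMap A S a) = regularGermHom x a) ∧
        ∀ k, e (OriginGerm.coord k) = lam (P.val k - algebraMap ℂ S (c k)) := by
  obtain ⟨y, rfl⟩ := Point.exists_restrict_eq S f hx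
  obtain ⟨e, he⟩ := exists_analyticGerm_restrict_algEquiv f y
  obtain ⟨e', he'⟩ := exists_originGerm_algEquiv P y
  refine ⟨e'.trans e.symm, e.symm.toAlgHom.comp (regularGermHom y), fun k => y.eval (P.val k),
    fun a => e.symm_apply_eq.mpr (he a).symm, fun k => congrArg e.symm (he' k)⟩

variable [Algebra S K] [IsScalarTower A S K] {lam : S →ₐ[ℂ] AnalyticGerm x}

variable (f) in
include f in
theorem isFunctionGerm_of_away [IsLocalization.Away f S]
    (hlam : ∀ a, lam (algebraMap A S a) = regularGermHom x a) (s : S) :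
    IsFunctionGerm x (algebraMap S K s) (lam s) := by
  obtain ⟨n, a, h⟩ := IsLocalization.Away.surj f s
  have hunit : IsUnit (algebraMap A K f) := by
    rw [IsScalarTower.algebraMap_apply A S K]
    exact (IsLocalization.Away.algebraMap_isUnit f).map (algebraMap S K)
  refine IsFunctionGerm.of_mul_regular (c := f ^ n) ?_ ?_
  · rw [map_pow]
    exact (hunit.pow n).ne_zero
  · rw [IsScalarTower.algebraMap_apply A S K, ← regularGermHom_apply, ← hlam, map_pow, ← map_mul,
      ← map_mul, h, hlam, ← IsScalarTower.algebraMap_apply A S K]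
    exact IsFunctionGerm.regular a

variable {κ : Type*} [Fintype κ] {u : κ → S} {b : Module.Basis κ S Ω[S⁄ℂ]}
  (hb : ∀ i, b i = D ℂ S (u i)) (hlam : ∀ a, lam (algebraMap A S a) = regularGermHom x a)
  {e : OriginGerm κ ≃ₐ[ℂ] AnalyticGerm x} {c : κ → ℂ}
  (he : ∀ i, e (OriginGerm.coord i) = lam (u i - algebraMap ℂ S (c i)))

variable (K) in
include hb hlam he in
theorem regularGermHom_injective_of_basis [FaithfulSMul A K] [IsDomain S]
    [Algebra.EssFiniteType ℂ S] : Function.Injective (regularGermHom x) := by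
  have hlam_inj : Function.Injective lam := by
    refine injective_of_algebraicIndependent (t := fun i => u i - algebraMap ℂ S (c i)) b
      (fun i => ?_) lam ?_
    · rw [hb, map_sub, Derivation.map_algebraMap, sub_zero]
    · simp only [← he]
      exact OriginGerm.algebraicIndependent_coord.map' (f := e.toAlgHom) e.injective
  have hA : Function.Injective (algebraMap A S) :=
    .of_comp (f := algebraMap S K) <| by
      rw [← RingHom.coe_comp, ← IsScalarTower.algebraMap_eq]
      exact FaithfulSMul.algebraMap_injective A K
  intro a a' h
  rw [← hlam, ← hlam] at h
  exact hA (hlam_inj h)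

variable [Algebra ℂ K] [IsScalarTower ℂ S K] [IsFractionRing S K] [DecidableEq κ]

variable (K f) in
include f hlam he in
theorem isFieldGerm_of_basis [IsLocalization.Away f S] (i : κ) :
    IsFieldGerm x
      ((Coordinates.ofBasis (fractionBasis b K) (fractionBasis_apply b hb K)).pderiv i)
      (conjDerivation e (OriginGerm.pderiv i)) := by
  intro a
  let C := Coordinates.ofBasis (fractionBasis b K) (fractionBasis_apply b hb K)
  have hrat : C.pderiv i (algebraMap S K (algebraMap A S a)) =
      algebraMap S K ((Coordinates.ofBasis b hb).pderiv i (algebraMap A S a)) :=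
    derivation_algHom_apply b hb (IsScalarTower.toAlgHom ℂ S K) (d := C.pderiv i)
      (C.pderiv_coord i) _
  have hcoord (j : κ) : conjDerivation e (OriginGerm.pderiv i) (lam (u j)) =
      if i = j then 1 else 0 := by
    rw [← sub_add_cancel (u j) (algebraMap ℂ S (c j)), map_add, ← he, AlgHom.commutes, map_add,
      Derivation.map_algebraMap, add_zero]
    exact (OriginGerm.coordinates.map e).pderiv_coord i j
  rw [← regularGermHom_apply, ← hlam, derivation_algHom_apply b hb lam hcoord,
    IsScalarTower.algebraMap_apply A S K, hrat]
  exact isFunctionGerm_of_away f hlam _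

variable (K f) in
/-- Functions on a principal open set whose differentials form a basis there, and which up to
constants correspond to the coordinates of `ℂ^κ`, are the coordinates of a chart. -/
def Chart.ofBasis [IsLocalization.Away f S] [FaithfulSMul A K] [IsDomain S]
    [Algebra.EssFiniteType ℂ S] :
    Chart (Coordinates.ofBasis (fractionBasis b K) (fractionBasis_apply b hb K)) x where
  equiv := e
  center := c
  isFunctionGerm i := by
    rw [he, IsScalarTower.algebraMap_apply ℂ S K]
    exact map_sub (algebraMap S K) (u i) _ ▸ isFunctionGerm_of_away f hlam _
  isFieldGerm := isFieldGerm_of_basis K f hb hlam he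
  regularGerm_injective := regularGermHom_injective_of_basis K hb hlam he

variable (K f) in
theorem exists_coordinates_forall_nonempty_chart [IsScalarTower ℂ A S] [IsLocalization.Away f S]
    [FaithfulSMul A K] [IsDomain S] [Algebra.EssFiniteType ℂ S] {ι σ : Type*} [Fintype ι]
    [DecidableEq ι] [Fintype σ] (P : Algebra.SubmersivePresentation ℂ S ι σ) :
    ∃ C : Coordinates ℂ K ((Set.range P.map)ᶜ : Set ι),
      ∀ x : Point A, x.eval f ≠ 0 → Nonempty (Chart C x) := by
  refine ⟨Coordinates.ofBasis (fractionBasis P.basisKaehler K)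
    (fractionBasis_apply P.basisKaehler P.basisKaehler_apply K), fun x hx => ?_⟩
  obtain ⟨e, lam, c, hlam, he⟩ := exists_originGerm_algEquiv_of_away P hx
  exact ⟨Chart.ofBasis K f P.basisKaehler_apply hlam he⟩

end Localization

/- Smooth varieties are standard smooth on the members of an affine open cover, and the function
field does not change when passing to such an open set. -/
theorem exists_chart [Algebra ℂ K] [IsDomain A] [IsFractionRing A K] [IsScalarTower ℂ A K]
    [Algebra.Smooth ℂ A] (x₀ : Point A) :
    ∃ f : A, x₀.eval f ≠ 0 ∧ ∃ (κ : Type) (_ : Fintype κ) (_ : DecidableEq κ)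
      (C : Coordinates ℂ K κ), ∀ x : Point A, x.eval f ≠ 0 → Nonempty (Chart C x) := by
  classical
  have : (RingHom.ker x₀.eval).IsPrime := RingHom.ker_isPrime _
  obtain ⟨f, hf, hstd⟩ := Algebra.IsSmoothAt.exists_notMem_isStandardSmooth (R := ℂ)
    (RingHom.ker x₀.eval)
  rw [RingHom.mem_ker] at hf
  obtain ⟨ι, σ, _, _, ⟨P⟩⟩ := hstd.out
  have := Fintype.ofFinite ι
  have := Fintype.ofFinite σ
  let S := Localization.Away f
  have hle : Submonoid.powers f ≤ nonZeroDivisors A :=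
    powers_le_nonZeroDivisors_of_noZeroDivisors fun h => hf (by rw [h, map_zero])
  have : IsDomain S := IsLocalization.isDomain_localization hle
  have : Algebra.EssFiniteType A S := .of_isLocalization S (.powers f)
  have : Algebra.EssFiniteType ℂ S := .comp ℂ A S
  let toK := Localization.mapToFractionRing K (.powers f) S hle
  let : Algebra S K := toK.toAlgebra
  have : IsScalarTower A S K := .of_algebraMap_eq fun a => (toK.commutes a).symm
  have : IsScalarTower ℂ S K := .to₁₃₄ ℂ A S K
  have : IsFractionRing S K :=
    IsFractionRing.isFractionRing_of_isDomain_of_isLocalization (.powers f) S K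
  obtain ⟨C, hC⟩ := exists_coordinates_forall_nonempty_chart K f P
  exact ⟨f, hf, _, inferInstance, inferInstance, C, hC⟩

end Charts

section Comparison

variable {A K : Type*} [CommRing A] [Algebra ℂ A]

/- The Nullstellensatz, applied to the open set `h ≠ 0` as an affine variety of its own. -/
theorem exists_point_eval_ne_zero [IsDomain A] [Algebra.FiniteType ℂ A] {h : A} (hh : h ≠ 0) :
    ∃ x : Point A, x.eval h ≠ 0 := by
  have : IsDomain (Localization.Away h) :=
    IsLocalization.isDomain_localization (powers_le_nonZeroDivisors_of_noZeroDivisors hh)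
  have : Algebra.FiniteType A (Localization.Away h) :=
    IsLocalization.finiteType_of_monoid_fg (.powers h) _
  have : Algebra.FiniteType ℂ (Localization.Away h) := .trans (S := A) inferInstance inferInstance
  obtain ⟨m, hm⟩ := Ideal.exists_maximal (Localization.Away h)
  let := Ideal.Quotient.field m
  have := finite_of_finite_type_of_isJacobsonRing ℂ (Localization.Away h ⧸ m)
  let φ : Localization.Away h →ₐ[ℂ] ℂ :=
    (IsAlgClosed.lift : (Localization.Away h ⧸ m) →ₐ[ℂ] ℂ).comp (Ideal.Quotient.mkₐ ℂ m)
  exact ⟨⟨φ.comp (IsScalarTower.toAlgHom ℂ A _)⟩,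
    ((IsLocalization.Away.algebraMap_isUnit h).map φ).ne_zero⟩

variable [Field K] [Algebra A K] [Algebra ℂ K]

namespace Chart

variable {κ : Type*} [Fintype κ] [DecidableEq κ] {C : Coordinates ℂ K κ} {x : Point A}
  (c : Chart C x)

/-- The analytic coordinates at `x` of a chart. -/
def coordinates : Coordinates ℂ (AnalyticGerm x) κ := OriginGerm.coordinates.map c.equiv

include c

theorem isDomain : IsDomain (AnalyticGerm x) := c.equiv.symm.toMulEquiv.isDomain _

theorem eq_zero_of_isFunctionGerm_zero {f : K} (h : IsFunctionGerm x f 0) : f = 0 := by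
  obtain ⟨b, e, he, hf, hb⟩ := h
  rw [zero_mul, ← regularGermHom_apply, eq_comm,
    map_eq_zero_iff _ c.regularGerm_injective] at hb
  rw [hb, map_zero] at hf
  exact (mul_eq_zero.mp hf).resolve_right he

theorem germ_eq_zero_of_isFunctionGerm [FaithfulSMul A K] {g : AnalyticGerm x}
    (h : IsFunctionGerm x (0 : K) g) : g = 0 := by
  have := c.isDomain
  obtain ⟨b, e, he, hb, hg⟩ := h
  rw [zero_mul, eq_comm, FaithfulSMul.algebraMap_eq_zero_iff] at hb
  rw [Ne, FaithfulSMul.algebraMap_eq_zero_iff] at he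
  rw [hb, ← regularGermHom_apply, ← regularGermHom_apply, map_zero] at hg
  exact (mul_eq_zero.mp hg).resolve_right ((map_ne_zero_iff _ c.regularGerm_injective).mpr he)

variable {Y : Derivation ℂ K K} {V : Derivation ℂ (AnalyticGerm x) (AnalyticGerm x)}

theorem isFunctionGerm_apply_coord (h : IsFieldGerm x Y V) (i : κ) :
    IsFunctionGerm x (Y (C.coord i)) (V (c.coordinates.coord i)) := by
  have hY : Y (C.coord i - algebraMap ℂ K (c.center i)) = Y (C.coord i) := by
    rw [map_sub, Y.map_algebraMap, sub_zero]
  exact hY ▸ (c.isFunctionGerm i).derivation h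

theorem isFieldGerm_of_apply_coord
    (h : ∀ i, IsFunctionGerm x (Y (C.coord i)) (V (c.coordinates.coord i))) :
    IsFieldGerm x Y V := by
  rw [C.derivation_eq_sum Y, c.coordinates.derivation_eq_sum V]
  exact IsFieldGerm.sum _ fun i _ => IsFieldGerm.smul (h i) (c.isFieldGerm i)

theorem eq_zero_of_isFieldGerm_zero (h : IsFieldGerm x Y 0) : Y = 0 :=
  C.derivation_eq_zero Y fun i =>
    c.eq_zero_of_isFunctionGerm_zero (c.isFunctionGerm_apply_coord h i)

theorem germ_eq_zero_of_isFieldGerm [FaithfulSMul A K]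
    (h : IsFieldGerm x (0 : Derivation ℂ K K) V) : V = 0 :=
  c.coordinates.derivation_eq_zero V fun i =>
    c.germ_eq_zero_of_isFunctionGerm (c.isFunctionGerm_apply_coord h i)

variable {D : Connection ℂ K}

theorem isConnectionGerm_connection {Γ : κ → Matrix κ κ (AnalyticGerm x)}
    (hΓ : ∀ i a b, IsFunctionGerm x (C.christoffel D i a b) (Γ i a b)) :
    IsConnectionGerm x D (c.coordinates.connection Γ) := by
  intro Y Z V W hY hZ
  have hcoord {Y V} (h : IsFieldGerm x Y V) := c.isFunctionGerm_apply_coord h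
  refine c.isFieldGerm_of_apply_coord fun a => ?_
  rw [C.cov_coord, c.coordinates.connection_cov_coord]
  exact ((hcoord hZ a).derivation hY).add (IsFunctionGerm.sum _ fun i _ =>
    IsFunctionGerm.sum _ fun b _ => (hcoord hY i).mul ((hΓ i a b).mul (hcoord hZ b)))

variable {E : Connection ℂ (AnalyticGerm x)} (hE : IsConnectionGerm x D E)

include hE

theorem hasParallelTorsion_germ [FaithfulSMul A K] (hD : D.HasParallelTorsion) :
    E.HasParallelTorsion := by
  refine Connection.hasParallelTorsion_of_span c.coordinates.span_pderiv ?_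
  rintro _ ⟨i, rfl⟩ _ ⟨j, rfl⟩ _ ⟨l, rfl⟩
  refine c.germ_eq_zero_of_isFieldGerm (K := K) ?_
  exact hD _ _ _ ▸ hE.covTorsion (c.isFieldGerm i) (c.isFieldGerm j) (c.isFieldGerm l)

theorem hasParallelTorsion_of_germ (h : E.HasParallelTorsion) : D.HasParallelTorsion := by
  refine Connection.hasParallelTorsion_of_span C.span_pderiv ?_
  rintro _ ⟨i, rfl⟩ _ ⟨j, rfl⟩ _ ⟨l, rfl⟩
  refine c.eq_zero_of_isFieldGerm_zero ?_
  exact h _ _ _ ▸ hE.covTorsion (c.isFieldGerm i) (c.isFieldGerm j) (c.isFieldGerm l)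

theorem span_isHorizontal_germ [FaithfulSMul A K] (hD : D.IsFlat) :
    Submodule.span (AnalyticGerm x) {Y | E.IsHorizontal Y} = ⊤ := by
  refine (OriginGerm.hasFundamentalSolutions.map c.equiv).span_isHorizontal fun i j b => ?_
  refine c.germ_eq_zero_of_isFieldGerm (K := K) ?_
  exact hD _ _ _ ▸ hE.curvature (c.isFieldGerm i) (c.isFieldGerm j) (c.isFieldGerm b)

end Chart

variable [IsDomain A] [IsFractionRing A K] [IsScalarTower ℂ A K] [Algebra.Smooth ℂ A]

/- A rational connection is regular wherever a common denominator of its Christoffel symbols does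
not vanish. -/
theorem exists_chart_isConnectionGerm (D : Connection ℂ K) :
    ∃ (x : Point A) (E : Connection ℂ (AnalyticGerm x)), IsConnectionGerm x D E ∧
      ∃ (κ : Type) (_ : Fintype κ) (_ : DecidableEq κ) (C : Coordinates ℂ K κ),
        Nonempty (Chart C x) := by
  obtain ⟨x₀, -⟩ := exists_point_eval_ne_zero (one_ne_zero (α := A))
  obtain ⟨f, hf, κ, _, _, C, hC⟩ := exists_chart (K := K) x₀
  have hf0 : f ≠ 0 := fun h => hf (by rw [h, map_zero])
  obtain ⟨⟨e, he⟩, hr⟩ := IsLocalization.exist_integer_multiples_of_finite (nonZeroDivisors A)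
    fun i : κ × κ × κ => C.christoffel D i.1 i.2.1 i.2.2
  choose r hr using hr
  have he0 : e ≠ 0 := nonZeroDivisors.ne_zero he
  obtain ⟨x, hx⟩ := exists_point_eval_ne_zero (mul_ne_zero hf0 he0)
  rw [map_mul, mul_ne_zero_iff] at hx
  obtain ⟨c⟩ := hC x hx.1
  obtain ⟨v, hv⟩ := (isUnit_regularGerm hx.2).exists_left_inv
  let Γ (i : κ) : Matrix κ κ (AnalyticGerm x) :=
    Matrix.of fun a b => regularGerm x (r (i, a, b)) * v
  refine ⟨x, c.coordinates.connection Γ, c.isConnectionGerm_connection fun i a b => ?_,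
    κ, _, _, C, ⟨c⟩⟩
  refine ⟨r (i, a, b), e, by rwa [Ne, FaithfulSMul.algebraMap_eq_zero_iff], ?_, ?_⟩
  · rw [hr, mul_comm, ← Algebra.smul_def]
  · change regularGerm x (r (i, a, b)) * v * regularGerm x e = _
    rw [mul_assoc, hv, mul_one]

theorem isLieConnection_iff (D : Connection ℂ K) :
    IsLieConnection A D ↔ D.IsFlat ∧ D.HasParallelTorsion := by
  refine and_congr_right fun hD => ⟨fun h => ?_, fun h x E hE Y Z hY hZ => ?_⟩
  · obtain ⟨x, E, hE, κ, _, _, C, ⟨c⟩⟩ := exists_chart_isConnectionGerm (A := A) D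
    exact c.hasParallelTorsion_of_germ hE
      (Connection.hasParallelTorsion_of_lie (c.span_isHorizontal_germ hE hD) (h x E hE))
  · obtain ⟨f, hf, κ, _, _, C, hC⟩ := exists_chart (K := K) x
    obtain ⟨c⟩ := hC x hf
    exact (c.hasParallelTorsion_germ hE h).isHorizontal_lie hY hZ

end Comparison

end LieConn

end

theorem proposition3p5 {A K : Type*} [CommRing A] [IsDomain A] [Algebra ℂ A] [Algebra.Smooth ℂ A]
    [Field K] [Algebra A K] [IsFractionRing A K] [Algebra ℂ K] [IsScalarTower ℂ A K]
    (D : LieConn.Connection ℂ K) :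
    List.TFAE [
      LieConn.IsLieConnection A D,
      LieConn.IsLieConnection A D.reciprocal,
      D.IsFlat ∧ D.HasParallelTorsion,
      D.IsFlat ∧ D.reciprocal.IsFlat] := by
  have h34 : (D.IsFlat ∧ D.HasParallelTorsion) ↔ (D.IsFlat ∧ D.reciprocal.IsFlat) :=
    and_congr_right fun h => h.hasParallelTorsion_iff
  have h24 : (D.reciprocal.IsFlat ∧ D.reciprocal.HasParallelTorsion) ↔
      (D.IsFlat ∧ D.reciprocal.IsFlat) := by
    rw [and_comm (a := D.IsFlat)]
    refine and_congr_right fun h => ?_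
    rw [h.hasParallelTorsion_iff, D.reciprocal_reciprocal]
  rw [LieConn.isLieConnection_iff, LieConn.isLieConnection_iff]
  tfae_have 3 ↔ 4 := h34
  tfae_have 2 ↔ 4 := h24
  tfae_have 1 ↔ 3 := Iff.rfl
  tfae_finish
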